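/- Let $k$ be a field and $R=k[x_0,x_1,x_2,x_3]$ with the bigrading $\deg x_0=\deg x_1=(1,0)$, $\deg x_2=\deg x_3=(0,1)$, the coordinate ring of $\mathbb P^1\times\mathbb P^1$; let $R(-p,-q)$ be the bigraded free module with $R(-p,-q)_{(u,v)}=R_{(u-p,v-q)}$. For a point $P=[a_0:a_1]\times[b_0:b_1]$ put $I_P=(a_1x_0-a_0x_1,\ b_1x_2-b_0x_3)$. Let $\alpha_1,\alpha_2,\beta_1,\beta_2$ be positive integers, let $H_1,\dots,H_{\alpha_1+\alpha_2}$ be distinct points of $\mathbb P^1$, let $V_1,\dots,V_{\beta_1+\beta_2}$ be distinct points of $\mathbb P^1$, and put $P_{ij}=H_i\times V_j$. Let $m\ge 0$ be an integer and let $\mathcal Z=\sum w_{ij}P_{ij}$ be the homogeneous fat almost complete intersection with $$w_{ij}=\begin{cases} m & \text{if } i\le\alpha_1 \text{ or } j\le\beta_1,\\ 0 & \text{otherwise,}\end{cases}\qquad I_{\mathcal Z}=\bigcap_{i,j} I_{P_{ij}}^{\,w_{ij}} .$$ Then $I_{\mathcal Z}$ has a minimal bigraded free resolution (an exact sequence with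 bidegree-preserving maps, in which the image of each map between free modules lies in $(x_0,x_1,x_2,x_3)$ times its target) of the form $$0\to\bigoplus_{(a,b,c,d)\in \mathcal B_2} R(-a\alpha_1-b\alpha_2,-c\beta_1-d\beta_2)\to\bigoplus_{(a,b,c,d)\in \mathcal B_1} R(-a\alpha_1-b\alpha_2,-c\beta_1-d\beta_2)\to\bigoplus_{(a,b,c,d)\in \mathcal B_0} R(-a\alpha_1-b\alpha_2,-c\beta_1-d\beta_2)\to I_{\mathcal Z}\to 0,$$ where $a,b,c,d$ are non-negative integers and - $\mathcal B_0=\{(a,b,c,d)\mid a+d=m,\ b+c=m,\ 0\le b\le a\le m\}$, - $\mathcal B_1=\{(a,b,c,d)\mid a+d=m+1,\ b+c=m,\ 0\le b<a\le m\}\cup\{(a,b,c,d)\mid a+d=m,\ b+c=m+1,\ 0<b\le a\le m\}$, - $\mathcal B_2=\{(a,b,c,d)\mid a+d=m+1,\ b+c=m+1,\ 0<b<a\le m\}$. -/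

import Mathlib

noncomputable section

namespace FatACI

open MvPolynomial
open scoped LinearAlgebra.Projectivization

/-- The coordinate ring `R = k[x₀, x₁, x₂, x₃]` of `ℙ¹ × ℙ¹`. -/
abbrev CoordRing (k : Type*) [Field k] : Type _ := MvPolynomial (Fin 4) k

/-- The bigrading: `deg x₀ = deg x₁ = (1, 0)` and `deg x₂ = deg x₃ = (0, 1)`.  Bidegrees are taken
in `ℤ × ℤ`, so that a form of a bidegree with a negative entry is zero. -/
def bideg : Fin 4 → ℤ × ℤ := ![(1, 0), (1, 0), (0, 1), (0, 1)]

/-- `f ∈ R_e`: the polynomial `f` is bihomogeneous of bidegree `e` (or zero). -/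
def IsBihomogeneous {k : Type*} [Field k] (f : CoordRing k) (e : ℤ × ℤ) : Prop :=
  IsWeightedHomogeneous bideg f e

/-- The ideal `(x₀, x₁, x₂, x₃)` of `R`. -/
def irrelevant (k : Type*) [Field k] : Ideal (CoordRing k) :=
  Ideal.span (Set.range X)

/-- `v` lies in the part of bidegree `e` of the bigraded free module `⨁ s, R(-p s)`, where
`R(-p)_e = R_{e - p}`. -/
def IsBihomogeneousVec {k : Type*} [Field k] {ι : Type*} (p : ι → ℤ × ℤ)
    (v : ι →₀ CoordRing k) (e : ℤ × ℤ) : Prop :=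
  ∀ s, IsBihomogeneous (v s) (e - p s)

/-- An exact sequence of bigraded `R`-modules
`0 → ⨁ R(-p₂ s) → ⨁ R(-p₁ s) → ⨁ R(-p₀ s) → I → 0` whose maps preserve the bidegree, that is
minimal: the image of each differential lies in `(x₀, x₁, x₂, x₃)` times its target. -/
structure MinimalResolution {k : Type*} [Field k] (I : Ideal (CoordRing k))
    {ι₂ ι₁ ι₀ : Type*} (p₂ : ι₂ → ℤ × ℤ) (p₁ : ι₁ → ℤ × ℤ) (p₀ : ι₀ → ℤ × ℤ) where
  /-- the differential `F₂ → F₁` -/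
  d₂ : (ι₂ →₀ CoordRing k) →ₗ[CoordRing k] (ι₁ →₀ CoordRing k)
  /-- the differential `F₁ → F₀` -/
  d₁ : (ι₁ →₀ CoordRing k) →ₗ[CoordRing k] (ι₀ →₀ CoordRing k)
  /-- the augmentation `F₀ → I` -/
  aug : (ι₀ →₀ CoordRing k) →ₗ[CoordRing k] I
  d₂_bihomogeneous : ∀ v e, IsBihomogeneousVec p₂ v e → IsBihomogeneousVec p₁ (d₂ v) e
  d₁_bihomogeneous : ∀ v e, IsBihomogeneousVec p₁ v e → IsBihomogeneousVec p₀ (d₁ v) e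
  aug_bihomogeneous : ∀ v e, IsBihomogeneousVec p₀ v e → IsBihomogeneous (aug v : CoordRing k) e
  d₂_injective : Function.Injective d₂
  exact₁ : Function.Exact d₂ d₁
  exact₀ : Function.Exact d₁ aug
  aug_surjective : Function.Surjective aug
  d₂_minimal : LinearMap.range d₂ ≤ irrelevant k • ⊤
  d₁_minimal : LinearMap.range d₁ ≤ irrelevant k • ⊤

/-- The ideal `I_P = (a₁ x₀ - a₀ x₁, b₁ x₂ - b₀ x₃)` of the point `P = [a₀ : a₁] × [b₀ : b₁]`.
It does not depend on the chosen homogeneous coordinates. -/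
def pointIdeal {k : Type*} [Field k] (A B : ℙ k (Fin 2 → k)) : Ideal (CoordRing k) :=
  Ideal.span {C (A.rep 1) * X 0 - C (A.rep 0) * X 1, C (B.rep 1) * X 2 - C (B.rep 0) * X 3}

/-- The multiplicities `w_{ij}` of the fat points `P_{ij} = H_i × V_j`.  Indices start at `0`. -/
def mult (α₁ β₁ m₁₁ m₁₂ m₂₁ : ℕ) (i j : ℕ) : ℕ :=
  if i < α₁ then (if j < β₁ then m₁₁ else m₁₂) else (if j < β₁ then m₂₁ else 0)

/-- The ideal `I_Z = ⋂ I_{P_{ij}} ^ w_{ij}` of the fat almost complete intersection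
`Z = ∑ w_{ij} P_{ij}`, with `P_{ij} = H_i × V_j`. -/
def fatIdeal {k : Type*} [Field k] {α₁ α₂ β₁ β₂ : ℕ}
    (H : Fin (α₁ + α₂) → ℙ k (Fin 2 → k)) (V : Fin (β₁ + β₂) → ℙ k (Fin 2 → k))
    (m₁₁ m₁₂ m₂₁ : ℕ) : Ideal (CoordRing k) :=
  ⨅ (i : Fin (α₁ + α₂)) (j : Fin (β₁ + β₂)),
    pointIdeal (H i) (V j) ^ mult α₁ β₁ m₁₁ m₁₂ m₂₁ i j

/-- The index set of the generators. -/
def B₀ (m : ℕ) : Set (ℕ × ℕ × ℕ × ℕ) :=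
  {(a, b, c, d) | a + d = m ∧ b + c = m ∧ 0 ≤ b ∧ b ≤ a ∧ a ≤ m}

/-- The index set of the first syzygies. -/
def B₁ (m : ℕ) : Set (ℕ × ℕ × ℕ × ℕ) :=
  {(a, b, c, d) | (a + d = m + 1 ∧ b + c = m ∧ 0 ≤ b ∧ b < a ∧ a ≤ m) ∨
    (a + d = m ∧ b + c = m + 1 ∧ 0 < b ∧ b ≤ a ∧ a ≤ m)}

/-- The index set of the second syzygies. -/
def B₂ (m : ℕ) : Set (ℕ × ℕ × ℕ × ℕ) :=
  {(a, b, c, d) | a + d = m + 1 ∧ b + c = m + 1 ∧ 0 < b ∧ b < a ∧ a ≤ m}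

/-- The bidegree `(a α₁ + b α₂, c β₁ + d β₂)` of the basis element with index `(a, b, c, d)`. -/
def twist (α₁ α₂ β₁ β₂ : ℕ) : ℕ × ℕ × ℕ × ℕ → ℤ × ℤ :=
  fun (a, b, c, d) => ((a * α₁ + b * α₂ : ℤ), (c * β₁ + d * β₂ : ℤ))

end FatACI

end

noncomputable section

namespace FatACI

open MvPolynomial
open scoped LinearAlgebra.Projectivization

/-! Let A₁, A₂ be the products of the linear forms of the first α₁ and last α₂ points H, and B₁, B₂
those of the first β₁ and last β₂ points V. The support is the union of two complete intersection
grids, and I_Z = (A₁A₂, B₁)^m ∩ (A₁, B₂)^m, since fat points of constant multiplicity on a grid give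
an ordinary power (`mem_span_prodForm_prodForm_pow`).

Forms in x₀, x₁ are regular against forms in x₂, x₃, and distinct points give coprime forms. These
facts, collected in `RegularQuadruple`, are all that exactness needs. They yield I_m = B₁^m (A₁,
B₂)^m + A₁A₂ I_{m-1}, so by induction on m the monomials A₁^a A₂^b B₁^(m-b) B₂^(m-a) with b ≤ a ≤ m
generate (`RegularQuadruple.exists_eq_sum`).

The generators are the lattice points (a, b) of a triangle. The first syzygies are its unit edges:
B₂ e(a,b) - A₁ e(a-1,b), with coefficients t, and B₁ e(a,b) - A₂ e(a,b-1), with coefficients u. The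
second syzygies are its unit squares, with coefficients g. `RegularQuadruple.exists_syzygy` repeats
the induction on m; `RegularQuadruple.exists_second_syzygy` solves for the squares row by row. All
matrix entries are 0, ±Aᵢ or ±Bᵢ, which gives the bidegrees and minimality. -/

/-- Multiplication by `t` is injective on `R ⧸ I`. -/
def RegularMod {R : Type*} [CommRing R] (I : Ideal R) (t : R) : Prop :=
  ∀ x, t * x ∈ I → x ∈ I

/-! ### Regular elements modulo powers of two-generated ideals -/

section Regular

variable {R : Type*} [CommRing R]

theorem RegularMod.one (I : Ideal R) : RegularMod I 1 := fun x hx => by simpa using hx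

theorem RegularMod.mul {I : Ideal R} {s t : R} (hs : RegularMod I s) (ht : RegularMod I t) :
    RegularMod I (s * t) := fun x hx => ht x (hs _ (by rwa [← mul_assoc]))

theorem RegularMod.prod {ι : Type*} {I : Ideal R} {t : ι → R} (S : Finset ι)
    (h : ∀ i ∈ S, RegularMod I (t i)) : RegularMod I (∏ i ∈ S, t i) := by
  classical
  induction S using Finset.induction_on with
  | empty => simpa using RegularMod.one I
  | insert a S ha ih =>
    rw [Finset.prod_insert ha]
    exact (h a (by simp)).mul (ih fun i hi => h i (by simp [hi]))

theorem RegularMod.pow {I : Ideal R} {t : R} (h : RegularMod I t) (n : ℕ) :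
    RegularMod I (t ^ n) := by
  induction n with
  | zero => simpa using RegularMod.one I
  | succ n ih => rw [pow_succ]; exact ih.mul h

theorem RegularMod.dvd {s t : R} (h : RegularMod (Ideal.span {s}) t) {x : R} (hx : s ∣ t * x) :
    s ∣ x :=
  Ideal.mem_span_singleton.1 (h x (Ideal.mem_span_singleton.2 hx))

/-- Two elements of a regular sequence may be exchanged if the first one is regular. -/
theorem RegularMod.exchange {I : Ideal R} {s t : R} (hs : RegularMod I s)
    (ht : RegularMod (I ⊔ Ideal.span {s}) t) : RegularMod (I ⊔ Ideal.span {t}) s := by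
  intro x hx
  obtain ⟨b, hb, z, hz, e⟩ := Submodule.mem_sup.1 hx
  obtain ⟨y, rfl⟩ := Ideal.mem_span_singleton.1 hz
  have h1 : t * y ∈ I ⊔ Ideal.span {s} := by
    have : t * y = -b + s * x := by rw [← e]; ring
    rw [this]
    exact Submodule.add_mem_sup (I.neg_mem hb) (Ideal.mem_span_singleton.2 (dvd_mul_right _ _))
  obtain ⟨b', hb', z', hz', e'⟩ := Submodule.mem_sup.1 (ht y h1)
  obtain ⟨z, rfl⟩ := Ideal.mem_span_singleton.1 hz'
  have h2 : x - t * z ∈ I := by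
    apply hs
    have : s * (x - t * z) = b + t * b' := by
      rw [mul_sub, ← e, ← e']; ring
    rw [this]
    exact I.add_mem hb (I.mul_mem_left _ hb')
  have : x = (x - t * z) + t * z := by ring
  rw [this]
  exact Submodule.add_mem_sup h2 (Ideal.mem_span_singleton.2 (dvd_mul_right _ _))

/-- Only the pure power of B among the monomials of degree n + 1 is not divisible by A. Peeling it
off drives the inductions on the exponent. -/
theorem mem_span_pair_pow_succ {A B : R} {n : ℕ} {x : R} :
    x ∈ Ideal.span {A, B} ^ (n + 1) ↔
      ∃ c, ∃ y ∈ Ideal.span {A, B} ^ n, x = c * B ^ (n + 1) + A * y := by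
  constructor
  · induction n generalizing x with
    | zero =>
      intro hx
      rw [zero_add, pow_one, Ideal.mem_span_pair] at hx
      obtain ⟨a, b, rfl⟩ := hx
      exact ⟨b, a, by simp, by ring⟩
    | succ n ih =>
      intro hx
      rw [pow_succ, mul_comm, Ideal.span_insert, Ideal.sup_mul] at hx
      obtain ⟨y, hy, z, hz, rfl⟩ := Submodule.mem_sup.1 hx
      obtain ⟨y', hy', rfl⟩ := Ideal.mem_span_singleton_mul.1 hy
      obtain ⟨z', hz', rfl⟩ := Ideal.mem_span_singleton_mul.1 hz
      rw [← Ideal.span_insert] at hy' hz'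
      obtain ⟨c, w, hw, rfl⟩ := ih hz'
      refine ⟨c, y' + B * w, ?_, by ring⟩
      refine Ideal.add_mem _ hy' ?_
      rw [pow_succ']
      exact Ideal.mul_mem_mul (Ideal.subset_span (by simp)) hw
  · rintro ⟨c, y, hy, rfl⟩
    refine Ideal.add_mem _ (Ideal.mul_mem_left _ _ (Ideal.pow_mem_pow
      (Ideal.subset_span (by simp)) _)) ?_
    rw [pow_succ']
    exact Ideal.mul_mem_mul (Ideal.subset_span (by simp)) hy

theorem mem_span_pair_pow {A B : R} {n : ℕ} {x : R} :
    x ∈ Ideal.span {A, B} ^ n ↔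
      ∃ c : ℕ → R, x = ∑ i ∈ Finset.range (n + 1), c i * (A ^ i * B ^ (n - i)) := by
  constructor
  · induction n generalizing x with
    | zero => exact fun _ => ⟨fun _ => x, by simp⟩
    | succ n ih =>
      intro hx
      obtain ⟨c, y, hy, rfl⟩ := mem_span_pair_pow_succ.1 hx
      obtain ⟨d, rfl⟩ := ih hy
      refine ⟨fun i => if i = 0 then c else d (i - 1), ?_⟩
      rw [Finset.sum_range_succ' _ (n + 1), add_comm]
      simp only [Finset.mul_sum, Nat.add_sub_add_right, Nat.add_sub_cancel, pow_zero, if_true,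
        Nat.succ_ne_zero, if_false, Nat.sub_zero, one_mul]
      congr 1
      exact Finset.sum_congr rfl fun i _ => by ring
  · rintro ⟨c, rfl⟩
    refine Ideal.sum_mem _ fun i hi => Ideal.mul_mem_left _ _ ?_
    have : i + (n - i) = n := by have := Finset.mem_range.1 hi; omega
    rw [← this, pow_add, Nat.add_sub_cancel_left]
    exact Ideal.mul_mem_mul (Ideal.pow_mem_pow (Ideal.subset_span (by simp)) _)
      (Ideal.pow_mem_pow (Ideal.subset_span (by simp)) _)

theorem mul_pow_mem_span_pair_pow {A B x y : R} {p q n : ℕ} (hx : A ∣ x) (hy : B ∣ y)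
    (h : n ≤ p + q) : x ^ p * y ^ q ∈ Ideal.span {A, B} ^ n := by
  refine Ideal.pow_le_pow_right h ?_
  rw [pow_add]
  exact Ideal.mul_mem_mul
    (Ideal.pow_mem_pow (Ideal.mem_of_dvd _ hx (Ideal.subset_span (by simp))) _)
    (Ideal.pow_mem_pow (Ideal.mem_of_dvd _ hy (Ideal.subset_span (by simp))) _)

/-- Regularity modulo `(A, B) ^ n + J`, from regularity modulo `(A ^ i, B) + J` for all `i`. -/
theorem RegularMod.span_pair_pow_sup {A B t : R} {J : Ideal R}
    (ht : ∀ i, RegularMod (Ideal.span {A ^ i} ⊔ J ⊔ Ideal.span {B}) t)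
    (hB : ∀ i, RegularMod (Ideal.span {A ^ i} ⊔ J) B) (n : ℕ) :
    RegularMod (Ideal.span {A, B} ^ n ⊔ J) t := by
  induction n with
  | zero => intro x _; simp
  | succ n ih =>
    -- Here the pure power of A is peeled off, so that B can be cancelled modulo (A^(n+1)) + J.
    have key : ∀ y, y ∈ Ideal.span {A, B} ^ (n + 1) ⊔ J ↔
        ∃ u ∈ Ideal.span {A ^ (n + 1)} ⊔ J, ∃ z ∈ Ideal.span {A, B} ^ n ⊔ J, y = u + B * z := by
      intro y
      constructor
      · intro hy
        obtain ⟨p, hp, j, hj, rfl⟩ := Submodule.mem_sup.1 hy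
        rw [Set.pair_comm] at hp
        obtain ⟨c, z, hz, rfl⟩ := mem_span_pair_pow_succ.1 hp
        rw [Set.pair_comm] at hz
        refine ⟨c * A ^ (n + 1) + j, Submodule.add_mem_sup (Ideal.mem_span_singleton.2
          (dvd_mul_left _ _)) hj, z, Ideal.mem_sup_left hz, by ring⟩
      · rintro ⟨u, hu, z, hz, rfl⟩
        refine Ideal.add_mem _ ?_ ?_
        · refine sup_le_sup_right ?_ J hu
          rw [Ideal.span_singleton_le_iff_mem]
          exact Ideal.pow_mem_pow (Ideal.subset_span (by simp)) _
        · obtain ⟨p, hp, j, hj, rfl⟩ := Submodule.mem_sup.1 hz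
          rw [mul_add]
          refine Submodule.add_mem_sup ?_ (J.mul_mem_left _ hj)
          rw [pow_succ']
          exact Ideal.mul_mem_mul (Ideal.subset_span (by simp)) hp
    have hle : Ideal.span {A ^ (n + 1)} ⊔ J ≤ Ideal.span {A, B} ^ n ⊔ J := by
      refine sup_le_sup_right ?_ J
      rw [Ideal.span_singleton_le_iff_mem]
      exact Ideal.pow_le_pow_right n.le_succ (Ideal.pow_mem_pow (Ideal.subset_span (by simp)) _)
    intro x hx
    obtain ⟨u, hu, z, hz, e⟩ := (key _).1 hx
    have h1 : x ∈ Ideal.span {A ^ (n + 1)} ⊔ J ⊔ Ideal.span {B} := by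
      apply ht
      rw [e]
      exact Submodule.add_mem_sup hu (Ideal.mem_span_singleton.2 (dvd_mul_right _ _))
    obtain ⟨α, hα, x', hx', rfl⟩ := Submodule.mem_sup.1 h1
    obtain ⟨x', rfl⟩ := Ideal.mem_span_singleton.1 hx'
    refine (key _).2 ⟨α, hα, x', ih _ ?_, rfl⟩
    have h2 : t * x' - z ∈ Ideal.span {A ^ (n + 1)} ⊔ J := by
      apply hB
      have : B * (t * x' - z) = u - t * α := by linear_combination e
      rw [this]
      exact Ideal.sub_mem _ hu (Ideal.mul_mem_left _ _ hα)
    have : t * x' = (t * x' - z) + z := by ring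
    rw [this]
    exact Ideal.add_mem _ (hle h2) hz

theorem RegularMod.span_pair_pow {A B t : R}
    (ht : ∀ i, RegularMod (Ideal.span {A ^ i} ⊔ Ideal.span {B}) t)
    (hB : ∀ i, RegularMod (Ideal.span {A ^ i}) B) (n : ℕ) :
    RegularMod (Ideal.span {A, B} ^ n) t := by
  have := RegularMod.span_pair_pow_sup (A := A) (B := B) (t := t) (J := ⊥)
    (fun i => by rw [sup_bot_eq]; exact ht i) (fun i => by rw [sup_bot_eq]; exact hB i) n
  rwa [sup_bot_eq] at this

/-- `(A, B) ^ n ∩ (A', B) ^ n ⊆ (A A', B) ^ n`. -/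
theorem mem_span_mul_pair_pow {A A' B : R} (hA : ∀ n, RegularMod (Ideal.span {A', B} ^ n) A)
    (hA' : ∀ n, RegularMod (Ideal.span {A, B} ^ n) A') {n : ℕ} {x : R}
    (h : x ∈ Ideal.span {A, B} ^ n) (h' : x ∈ Ideal.span {A', B} ^ n) :
    x ∈ Ideal.span {A * A', B} ^ n := by
  induction n generalizing x with
  | zero => simp
  | succ n ih =>
    have hB : ∀ (C c : R) (m : ℕ), m ≤ n + 1 → c * B ^ (n + 1) ∈ Ideal.span {C, B} ^ m :=
      fun C c m hm => Ideal.mul_mem_left _ _ (Ideal.pow_le_pow_right hm (Ideal.pow_mem_pow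
        (Ideal.subset_span (by simp)) _))
    obtain ⟨c, g, hg, rfl⟩ := mem_span_pair_pow_succ.1 h
    -- The term c B^(n+1) lies in both powers, so it drops out and A can be cancelled.
    have h1 : g ∈ Ideal.span {A', B} ^ (n + 1) :=
      hA _ _ ((Ideal.add_mem_iff_right _ (hB A' c _ le_rfl)).1 h')
    obtain ⟨d, y, hy, rfl⟩ := mem_span_pair_pow_succ.1 h1
    have h2 : y ∈ Ideal.span {A, B} ^ n :=
      hA' _ _ ((Ideal.add_mem_iff_right _ (hB A d _ n.le_succ)).1 hg)
    exact mem_span_pair_pow_succ.2 ⟨c + A * d, y, ih h2 hy, by ring⟩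

/-- `(A, B) ^ (n + 1) : A = (A, B) ^ n`. -/
theorem mem_span_pair_pow_of_mul_mem {A B : R} [IsDomain R] (hA : A ≠ 0)
    (hB : RegularMod (Ideal.span {A}) B) {n : ℕ} {x : R}
    (h : A * x ∈ Ideal.span {A, B} ^ (n + 1)) : x ∈ Ideal.span {A, B} ^ n := by
  obtain ⟨c, y, hy, e⟩ := mem_span_pair_pow_succ.1 h
  have h1 : A ∣ B ^ (n + 1) * c := ⟨x - y, by linear_combination -e⟩
  obtain ⟨d, rfl⟩ := (hB.pow _).dvd h1
  have : x = d * B ^ (n + 1) + y := mul_left_cancel₀ hA (by linear_combination e)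
  rw [this]
  exact Ideal.add_mem _ (Ideal.mul_mem_left _ _ (Ideal.pow_le_pow_right n.le_succ
    (Ideal.pow_mem_pow (Ideal.subset_span (by simp)) _))) hy

end Regular

/-! ### Generators and syzygies for a regular quadruple -/

section Exactness

variable {R : Type*} [CommRing R] [IsDomain R]

/-- The syzygies of the generators of `(A, B) ^ n`. -/
theorem exists_syzygy_span_pair_pow {A B : R} (hA : A ≠ 0) (hB : RegularMod (Ideal.span {A}) B)
    {n : ℕ} {c : ℕ → R} (hc : ∀ a, n < a → c a = 0)
    (h : ∑ a ∈ Finset.range (n + 1), c a * (A ^ a * B ^ (n - a)) = 0) :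
    ∃ t : ℕ → R, t 0 = 0 ∧ (∀ a, n < a → t a = 0) ∧ ∀ a, c a = B * t a - A * t (a + 1) := by
  induction n generalizing c with
  | zero =>
    refine ⟨0, rfl, fun _ _ => rfl, fun a => ?_⟩
    rcases a with _ | a
    · simpa using h
    · simpa using hc (a + 1) (by omega)
  | succ n ih =>
    rw [Finset.sum_range_succ'] at h
    simp only [Nat.add_sub_add_right, pow_zero, Nat.sub_zero, one_mul] at h
    have e : ∑ a ∈ Finset.range (n + 1), c (a + 1) * (A ^ (a + 1) * B ^ (n - a)) =
        A * ∑ a ∈ Finset.range (n + 1), c (a + 1) * (A ^ a * B ^ (n - a)) := by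
      rw [Finset.mul_sum]; exact Finset.sum_congr rfl fun i _ => by ring
    rw [e] at h
    have h1 : A ∣ B ^ (n + 1) * c 0 := ⟨-∑ a ∈ Finset.range (n + 1), c (a + 1) * (A ^ a * B ^ (n - a)),
      by linear_combination h⟩
    obtain ⟨s, hs⟩ := (hB.pow _).dvd h1
    -- As c 0 = A s, the lowest term A s B^(n+1) is absorbed into the next coefficient as B s; this
    -- also dictates t 1 = -s.
    obtain ⟨t, t0, tn, ht⟩ := ih (c := fun a => c (a + 1) + if a = 0 then B * s else 0)
      (fun a ha => by simp [hc (a + 1) (by omega), show a ≠ 0 by omega]) (by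
        apply mul_left_cancel₀ hA
        simp only [add_mul, Finset.sum_add_distrib, ite_mul, zero_mul]
        rw [Finset.sum_ite_eq' _ 0]
        simp only [Finset.mem_range, Nat.succ_pos, if_true, pow_zero, Nat.sub_zero]
        linear_combination h - B ^ (n + 1) * hs)
    refine ⟨fun a => if a = 0 then 0 else if a = 1 then -s else t (a - 1), by simp,
      fun a ha => ?_, fun a => ?_⟩
    · simp only [show a ≠ 0 by omega, show a ≠ 1 by omega, if_false]
      exact tn _ (by omega)
    · rcases a with _ | _ | a
      · simpa using hs
      · have := ht 0
        simp [t0] at this ⊢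
        linear_combination this
      · simpa using ht (a + 1)

variable {A₁ A₂ B₁ B₂ : R}

/-- The regularity properties of the four forms that the resolution rests on. -/
structure RegularQuadruple (A₁ A₂ B₁ B₂ : R) : Prop where
  A₁_ne : A₁ ≠ 0
  A₂_ne : A₂ ≠ 0
  B₂_mod_A₁ : RegularMod (Ideal.span {A₁}) B₂
  A₁_mod_A₂ : RegularMod (Ideal.span {A₂}) A₁
  B₁_mod_A₁A₂ : RegularMod (Ideal.span {A₁ * A₂}) B₁
  A₂_mod_pow : ∀ n, RegularMod (Ideal.span {A₁, B₂} ^ n) A₂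
  B₁_mod_pow_sup : ∀ n, RegularMod (Ideal.span {A₁, B₂} ^ n ⊔ Ideal.span {A₁ * A₂}) B₁

/-- Cancelling A₂ costs nothing, since it is regular modulo the power; cancelling A₁ lowers the
order by one. -/
theorem RegularQuadruple.mem_of_mul_mem (hq : RegularQuadruple A₁ A₂ B₁ B₂) {n : ℕ} {x : R}
    (h : A₁ * A₂ * x ∈ Ideal.span {A₁, B₂} ^ (n + 1)) : x ∈ Ideal.span {A₁, B₂} ^ n :=
  mem_span_pair_pow_of_mul_mem hq.A₁_ne hq.B₂_mod_A₁
    (hq.A₂_mod_pow _ _ (by rwa [mul_left_comm, ← mul_assoc]))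

/-- `(A₁ A₂, B₁) ^ m ∩ (A₁, B₂) ^ m` is generated by the `A₁ ^ a A₂ ^ b B₁ ^ (m - b) B₂ ^ (m - a)`
with `b ≤ a ≤ m`. -/
theorem RegularQuadruple.exists_eq_sum (hq : RegularQuadruple A₁ A₂ B₁ B₂) {m : ℕ} {f : R}
    (h : f ∈ Ideal.span {A₁ * A₂, B₁} ^ m) (h' : f ∈ Ideal.span {A₁, B₂} ^ m) :
    ∃ y : ℕ → ℕ → R, (∀ a b, ¬ (b ≤ a ∧ a ≤ m) → y a b = 0) ∧
      f = ∑ b ∈ Finset.range (m + 1), ∑ a ∈ Finset.range (m + 1),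
        y a b * (A₁ ^ a * A₂ ^ b * B₁ ^ (m - b) * B₂ ^ (m - a)) := by
  induction m generalizing f with
  | zero =>
    refine ⟨fun a b => if b ≤ a ∧ a ≤ 0 then f else 0, fun a b hab => if_neg hab, by simp⟩
  | succ n ih =>
    obtain ⟨c, g, hg, rfl⟩ := mem_span_pair_pow_succ.1 h
    have h1 : c ∈ Ideal.span {A₁, B₂} ^ (n + 1) ⊔ Ideal.span {A₁ * A₂} := by
      apply (hq.B₁_mod_pow_sup (n + 1)).pow (n + 1)
      have : B₁ ^ (n + 1) * c = (c * B₁ ^ (n + 1) + A₁ * A₂ * g) + A₁ * A₂ * (-g) := by ring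
      rw [this]
      exact Submodule.add_mem_sup h' (Ideal.mem_span_singleton.2 (dvd_mul_right _ _))
    obtain ⟨p, hp, z, hz, rfl⟩ := Submodule.mem_sup.1 h1
    obtain ⟨z, rfl⟩ := Ideal.mem_span_singleton.1 hz
    -- The part A₁A₂z of c is moved into g; the new cofactor of A₁A₂ lies in both n-th powers.
    have h2 : g + z * B₁ ^ (n + 1) ∈ Ideal.span {A₁ * A₂, B₁} ^ n :=
      Ideal.add_mem _ hg (Ideal.mul_mem_left _ _ (Ideal.pow_le_pow_right n.le_succ
        (Ideal.pow_mem_pow (Ideal.subset_span (by simp)) _)))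
    have h3 : g + z * B₁ ^ (n + 1) ∈ Ideal.span {A₁, B₂} ^ n := by
      apply hq.mem_of_mul_mem
      have : A₁ * A₂ * (g + z * B₁ ^ (n + 1)) =
        ((p + A₁ * A₂ * z) * B₁ ^ (n + 1) + A₁ * A₂ * g) - B₁ ^ (n + 1) * p := by ring
      rw [this]
      exact Ideal.sub_mem _ h' (Ideal.mul_mem_left _ _ hp)
    obtain ⟨y, hy, e⟩ := ih h2 h3
    obtain ⟨w, hw⟩ := mem_span_pair_pow.1 hp
    -- Row b = 0 comes from p. The rest is the inductive solution shifted by (1, 1), because A₁A₂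
    -- times the generator (a, b) of level n is the generator (a + 1, b + 1) of level n + 1.
    refine ⟨fun a b => if b = 0 then (if a ≤ n + 1 then w a else 0) else
      if a = 0 then 0 else y (a - 1) (b - 1), fun a b hab => ?_, ?_⟩
    · rcases b with _ | b
      · have : ¬ a ≤ n + 1 := by omega
        simp [this]
      · rcases a with _ | a
        · simp
        · simpa using hy a b (by omega)
    · rw [Finset.sum_range_succ' _ (n + 1)]
      simp only [if_true, Nat.succ_ne_zero, if_false]
      have e1 : ∑ a ∈ Finset.range (n + 1 + 1), (if a ≤ n + 1 then w a else 0) *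
          (A₁ ^ a * A₂ ^ 0 * B₁ ^ (n + 1 - 0) * B₂ ^ (n + 1 - a)) =
          p * B₁ ^ (n + 1) := by
        rw [hw, Finset.sum_mul]
        refine Finset.sum_congr rfl fun a ha => ?_
        rw [if_pos (by have := Finset.mem_range.1 ha; omega)]
        simp only [Nat.sub_zero, pow_zero]
        ring
      have e2 : ∑ b ∈ Finset.range (n + 1), ∑ a ∈ Finset.range (n + 1 + 1),
          (if a = 0 then 0 else y (a - 1) (b + 1 - 1)) *
          (A₁ ^ a * A₂ ^ (b + 1) * B₁ ^ (n + 1 - (b + 1)) * B₂ ^ (n + 1 - a)) =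
          A₁ * A₂ * (g + z * B₁ ^ (n + 1)) := by
        rw [e, Finset.mul_sum]
        refine Finset.sum_congr rfl fun b _ => ?_
        rw [Finset.sum_range_succ' _ (n + 1), Finset.mul_sum]
        simp only [if_true, zero_mul, add_zero, Nat.succ_ne_zero, if_false, Nat.add_sub_add_right,
          Nat.add_sub_cancel]
        exact Finset.sum_congr rfl fun a _ => by ring
      rw [e1, e2]
      ring

/-- Exactness at the free module on the generators, in coordinates. -/
theorem RegularQuadruple.exists_syzygy (hq : RegularQuadruple A₁ A₂ B₁ B₂) {m : ℕ}
    {y : ℕ → ℕ → R} (hy : ∀ a b, ¬ (b ≤ a ∧ a ≤ m) → y a b = 0)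
    (h : ∑ b ∈ Finset.range (m + 1), ∑ a ∈ Finset.range (m + 1),
        y a b * (A₁ ^ a * A₂ ^ b * B₁ ^ (m - b) * B₂ ^ (m - a)) = 0) :
    ∃ t u : ℕ → ℕ → R, (∀ a b, ¬ (b < a ∧ a ≤ m) → t a b = 0) ∧
      (∀ a b, ¬ (0 < b ∧ b ≤ a ∧ a ≤ m) → u a b = 0) ∧
      ∀ a b, y a b = B₂ * t a b - A₁ * t (a + 1) b + B₁ * u a b - A₂ * u a (b + 1) := by
  induction m generalizing y with
  | zero =>
    refine ⟨0, 0, fun _ _ _ => rfl, fun _ _ _ => rfl, fun a b => ?_⟩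
    by_cases hab : b ≤ a ∧ a ≤ 0
    · obtain ⟨h1, h2⟩ := hab
      obtain rfl : a = 0 := by omega
      obtain rfl : b = 0 := by omega
      simpa using h
    · simpa using hy a b hab
  | succ n ih =>
    have hA : A₁ * A₂ ≠ 0 := mul_ne_zero hq.A₁_ne hq.A₂_ne
    -- ρ is row b = 0 without its factor B₁^(n+1); τ is the sum of the other rows without A₁A₂.
    obtain ⟨ρ, hρ⟩ : ∃ ρ, ρ = ∑ a ∈ Finset.range (n + 1 + 1), y a 0 *
      (A₁ ^ a * B₂ ^ (n + 1 - a)) := ⟨_, rfl⟩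
    obtain ⟨τ, hτ⟩ : ∃ τ, τ = ∑ b ∈ Finset.range (n + 1), ∑ a ∈ Finset.range (n + 1),
      y (a + 1) (b + 1) * (A₁ ^ a * A₂ ^ b * B₁ ^ (n - b) * B₂ ^ (n - a)) := ⟨_, rfl⟩
    have h1 : A₁ * A₂ * τ + ρ * B₁ ^ (n + 1) = 0 := by
      rw [← h, Finset.sum_range_succ', hρ, hτ, Finset.mul_sum, Finset.sum_mul]
      congr 1
      · refine Finset.sum_congr rfl fun b _ => ?_
        rw [Finset.sum_range_succ' _ (n + 1), hy 0 (b + 1) (by omega), Finset.mul_sum]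
        simp only [zero_mul, add_zero, Nat.add_sub_add_right]
        exact Finset.sum_congr rfl fun a _ => by ring
      · exact Finset.sum_congr rfl fun a _ => by rw [Nat.sub_zero]; ring
    obtain ⟨σ, hσ⟩ := (hq.B₁_mod_A₁A₂.pow (n + 1)).dvd (x := ρ)
      ⟨-τ, by linear_combination h1⟩
    have h2 : σ ∈ Ideal.span {A₁, B₂} ^ n := by
      apply hq.mem_of_mul_mem
      rw [← hσ]
      exact mem_span_pair_pow.2 ⟨_, hρ⟩
    obtain ⟨w, hw, hw0⟩ : ∃ w : ℕ → R,
        σ = ∑ i ∈ Finset.range (n + 1), w i * (A₁ ^ i * B₂ ^ (n - i)) ∧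
        ∀ a, n < a → w a = 0 := by
      obtain ⟨w, hw⟩ := mem_span_pair_pow.1 h2
      refine ⟨fun a => if a ≤ n then w a else 0, ?_, fun a ha => if_neg (by omega)⟩
      rw [hw]
      exact Finset.sum_congr rfl fun a ha => by
        simp only [if_pos (show a ≤ n by have := Finset.mem_range.1 ha; omega)]
    -- Since ρ = A₁A₂σ, the edges from row 0 to row 1 with coefficients -w carry this part upwards.
    -- What remains in row 0 is a syzygy of the generators of (A₁, B₂)^(n+1).
    obtain ⟨r, r0, rn, hr⟩ := exists_syzygy_span_pair_pow hq.A₁_ne hq.B₂_mod_A₁ (n := n + 1)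
      (c := fun a => y a 0 - if a = 0 then 0 else A₂ * w (a - 1))
      (fun a ha => by simp [hy a 0 (by omega), show a ≠ 0 by omega, hw0 (a - 1) (by omega)]) (by
        simp only [sub_mul, Finset.sum_sub_distrib]
        rw [← hρ, Finset.sum_range_succ', hσ, hw, Finset.mul_sum, sub_eq_zero]
        simp only [if_true, zero_mul, add_zero, Nat.succ_ne_zero, if_false, Nat.add_sub_add_right,
          Nat.add_sub_cancel]
        exact Finset.sum_congr rfl fun a _ => by ring)
    -- Row 1 receives the transferred part as B₁ w; rows b ≥ 1 then form a relation of level n.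
    obtain ⟨t, u, ht, hu, htu⟩ := ih
      (y := fun a b => y (a + 1) (b + 1) + if b = 0 then B₁ * w a else 0)
      (fun a b hab => by
        rw [hy _ _ (by omega)]
        rcases b with _ | b
        · simp [hw0 a (by omega)]
        · simp) (by
        simp only [add_mul, Finset.sum_add_distrib]
        rw [← hτ]
        have : ∑ b ∈ Finset.range (n + 1), ∑ a ∈ Finset.range (n + 1),
            (if b = 0 then B₁ * w a else 0) * (A₁ ^ a * A₂ ^ b * B₁ ^ (n - b) * B₂ ^ (n - a)) =
            B₁ ^ (n + 1) * σ := by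
          rw [Finset.sum_range_succ', hw, Finset.mul_sum]
          simp only [Nat.succ_ne_zero, if_false, zero_mul, Finset.sum_const_zero, if_true, zero_add]
          exact Finset.sum_congr rfl fun a _ => by rw [Nat.sub_zero]; ring
        rw [this]
        apply mul_left_cancel₀ hA
        linear_combination h1 - B₁ ^ (n + 1) * hσ)
    refine ⟨fun a b => if b = 0 then r a else if a = 0 then 0 else t (a - 1) (b - 1),
      fun a b => if a = 0 ∨ b = 0 then 0 else u (a - 1) (b - 1) - if b = 1 then w (a - 1) else 0,
      fun a b hab => ?_, fun a b hab => ?_, fun a b => ?_⟩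
    · rcases b with _ | b
      · rcases a with _ | a
        · simpa using r0
        · simpa using rn (a + 1) (by omega)
      · rcases a with _ | a
        · simp
        · simpa using ht a b (by omega)
    · rcases a with _ | a
      · simp
      · rcases b with _ | _ | b
        · simp
        · simp [hu a 0 (by omega), hw0 a (by omega)]
        · simpa using hu a (b + 1) (by omega)
    · rcases a with _ | a
      · rcases b with _ | b
        · simpa [r0] using hr 0
        · simp [hy 0 (b + 1) (by omega), ht 0 b (by omega)]
      · rcases b with _ | _ | b
        · have := hr (a + 1)
          simp [hu a 0 (by omega)] at this ⊢
          linear_combination this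
        · have := htu a 0
          simp at this ⊢
          linear_combination this
        · have := htu a (b + 1)
          simpa using this

/-- Exactness at the free module on the first syzygies, in coordinates. -/
theorem RegularQuadruple.exists_second_syzygy (hq : RegularQuadruple A₁ A₂ B₁ B₂) {m : ℕ}
    {t u : ℕ → ℕ → R} (ht : ∀ a b, ¬ (b < a ∧ a ≤ m) → t a b = 0)
    (hu : ∀ a b, ¬ (0 < b ∧ b ≤ a ∧ a ≤ m) → u a b = 0)
    (h : ∀ a b, B₂ * t a b - A₁ * t (a + 1) b + B₁ * u a b - A₂ * u a (b + 1) = 0) :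
    ∃ g : ℕ → ℕ → R, (∀ a b, ¬ (0 < b ∧ b < a ∧ a ≤ m) → g a b = 0) ∧
      (∀ a b, t a b = A₂ * g a (b + 1) - B₁ * g a b) ∧
      ∀ a b, u a b = B₂ * g a b - A₁ * g (a + 1) b := by
  classical
  -- The equation for t is solved for the next row: A₂ g(a, b+1) = t(a, b) + B₁ g(a, b). The default
  -- 0 only makes the recursion total; divisibility is proved in `step`. The row index b comes first
  -- here.
  let g : ℕ → ℕ → R := fun b => Nat.rec (fun _ => 0) (fun b gb a =>
    if hd : A₂ ∣ t a b + B₁ * gb a then hd.choose else 0) b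
  have g0 : ∀ a, g 0 a = 0 := fun _ => rfl
  have gs : ∀ b a, A₂ ∣ t a b + B₁ * g b a → t a b + B₁ * g b a = A₂ * g (b + 1) a := by
    intro b a hd
    have : g (b + 1) a = hd.choose := dif_pos hd
    rw [this]
    exact hd.choose_spec
  have step : ∀ b, (∀ a, u a b = B₂ * g b a - A₁ * g b (a + 1)) →
      (∀ a, ¬ (0 < b ∧ b < a ∧ a ≤ m) → g b a = 0) →
      (∀ a, t a b + B₁ * g b a = A₂ * g (b + 1) a) ∧
      (∀ a, u a (b + 1) = B₂ * g (b + 1) a - A₁ * g (b + 1) (a + 1)) ∧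
      ∀ a, ¬ (0 < b + 1 ∧ b + 1 < a ∧ a ≤ m) → g (b + 1) a = 0 := by
    intro b hb hg
    -- Modulo A₂ this passes divisibility from a to a + 1, starting from the zero value at a = 0.
    have hd : ∀ a, A₁ * (t (a + 1) b + B₁ * g b (a + 1)) =
        B₂ * (t a b + B₁ * g b a) - A₂ * u a (b + 1) := fun a => by
      linear_combination -h a b + B₁ * hb a
    have hz : ∀ a, ¬ (b < a ∧ a ≤ m) → t a b + B₁ * g b a = 0 := fun a ha => by
      rw [ht a b ha, hg a (by omega), mul_zero, add_zero]
    have hs : ∀ a, t a b + B₁ * g b a = A₂ * g (b + 1) a := by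
      intro a
      apply gs
      induction a with
      | zero => rw [hz 0 (by omega)]; exact dvd_zero _
      | succ a ih =>
        refine hq.A₁_mod_A₂.dvd ?_
        rw [hd]
        exact dvd_sub (ih.mul_left _) (dvd_mul_right _ _)
    refine ⟨hs, fun a => ?_, fun a ha => ?_⟩
    · apply mul_left_cancel₀ hq.A₂_ne
      linear_combination hd a - A₁ * hs (a + 1) + B₂ * hs a
    · apply (mul_eq_zero.1 ?_).resolve_left hq.A₂_ne
      rw [← hs]
      -- An edge t(b+1, b) may be present on the diagonal boundary, but no square lies above it;
      -- `hd` at a = b forces the value to vanish.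
      by_cases hab : a = b + 1
      · subst hab
        apply (mul_eq_zero.1 ?_).resolve_left hq.A₁_ne
        rw [hd, hz b (by omega), hu b (b + 1) (by omega)]
        simp
      · exact hz a (by omega)
  have all : ∀ b, (∀ a, u a b = B₂ * g b a - A₁ * g b (a + 1)) ∧
      ∀ a, ¬ (0 < b ∧ b < a ∧ a ≤ m) → g b a = 0 := by
    intro b
    induction b with
    | zero => exact ⟨fun a => by simp [g0, hu a 0], fun a _ => g0 a⟩
    | succ b ih => exact (step b ih.1 ih.2).2
  exact ⟨fun a b => g b a, fun a b => (all b).2 a,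
    fun a b => by linear_combination (step b (all b).1 (all b).2).1 a, fun a b => (all b).1 a⟩

end Exactness

/-! ### Linear forms in two variables and their products -/

section LinearForms

variable {σ k : Type*} [Field k]

theorem divMonomial_supported_mul {i : σ} {s : MvPolynomial σ k} (hs : s ∈ supported k {i}ᶜ)
    (r : MvPolynomial σ k) :
    (s * r).divMonomial (Finsupp.single i 1) = s * r.divMonomial (Finsupp.single i 1) := by
  classical
  unfold supported at hs
  induction hs using Algebra.adjoin_induction generalizing r with
  | mem x hx =>
    obtain ⟨j, hj, rfl⟩ := hx
    have hij : i ≠ j := fun h => hj h.symm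
    ext n
    simp only [coeff_divMonomial, coeff_X_mul', Finsupp.mem_support_iff, Finsupp.add_apply,
      Finsupp.single_apply, if_neg hij, zero_add]
    split_ifs with h
    · congr 1
      ext l
      simp only [Finsupp.add_apply, Finsupp.tsub_apply, Finsupp.single_apply]
      split_ifs <;> first | omega | (subst_vars; exact absurd rfl hij)
    · rfl
  | algebraMap c =>
    ext n
    rw [algebraMap_eq, coeff_divMonomial, coeff_C_mul, coeff_C_mul, coeff_divMonomial]
  | add x y _ _ hx hy => rw [add_mul, add_divMonomial, hx, hy, add_mul]
  | mul x y _ _ hx hy => rw [mul_assoc, hx, hy, mul_assoc]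

/-- Division by X i, discarding the monomials it does not divide, is a left inverse of
multiplication by X i. It is linear over polynomials free of X i, hence preserves the ideal. -/
theorem regularMod_X {i : σ} {S : Set (MvPolynomial σ k)}
    (hS : S ⊆ (supported k {i}ᶜ : Subalgebra k (MvPolynomial σ k))) :
    RegularMod (Ideal.span S) (X i) := by
  have key : ∀ f ∈ Ideal.span S, ∀ r, (r * f).divMonomial (Finsupp.single i 1) ∈ Ideal.span S := by
    intro f hf
    induction hf using Submodule.span_induction with
    | mem s hs =>
      intro r
      rw [mul_comm, divMonomial_supported_mul (hS hs)]
      exact Ideal.mul_mem_right _ _ (Ideal.subset_span hs)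
    | zero => intro r; simp
    | add x y _ _ hx hy =>
      intro r
      rw [mul_add, add_divMonomial]
      exact Ideal.add_mem _ (hx r) (hy r)
    | smul a x _ hx =>
      intro r
      rw [smul_eq_mul, ← mul_assoc]
      exact hx _
  intro x hx
  simpa using key _ hx 1

/-- The substitution X i ↦ 0 fixes S and X j and changes a polynomial only by a multiple of X i, so
`regularMod_X` applies to its image. -/
theorem regularMod_sup_X {i j : σ} (hij : i ≠ j) {S : Set (MvPolynomial σ k)}
    (hS : S ⊆ (supported k {i, j}ᶜ : Subalgebra k (MvPolynomial σ k))) :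
    RegularMod (Ideal.span S ⊔ Ideal.span {X i}) (X j) := by
  classical
  let φ : MvPolynomial σ k →ₐ[k] MvPolynomial σ k := aeval (Function.update X i 0)
  have φX : ∀ l, l ≠ i → φ (X l) = X l := fun l hl => by simp [φ, hl]
  have φi : φ (X i) = 0 := by simp [φ]
  have φS : ∀ s ∈ S, φ s = s := by
    intro s hs
    have : supported k {i, j}ᶜ ≤ AlgHom.equalizer φ (AlgHom.id k _) := by
      refine Algebra.adjoin_le ?_
      rintro _ ⟨l, hl, rfl⟩
      exact φX l fun h => hl (by simp [h])
    exact this (hS hs)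
  have hmap : Ideal.span S ⊔ Ideal.span {X i} ≤ (Ideal.span S).comap φ := by
    refine sup_le (Ideal.span_le.2 fun s hs => ?_) (Ideal.span_le.2 ?_)
    · rw [SetLike.mem_coe, Ideal.mem_comap, φS s hs]
      exact Ideal.subset_span hs
    · rintro _ rfl
      rw [SetLike.mem_coe, Ideal.mem_comap, φi]
      exact zero_mem _
  have hsub : ∀ x, x - φ x ∈ Ideal.span {(X i : MvPolynomial σ k)} := by
    intro x
    rw [← Ideal.Quotient.mk_eq_mk_iff_sub_mem]
    have : (Ideal.Quotient.mkₐ k (Ideal.span {(X i : MvPolynomial σ k)})) =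
        (Ideal.Quotient.mkₐ k (Ideal.span {(X i : MvPolynomial σ k)})).comp φ := by
      ext l
      by_cases hl : l = i
      · subst hl
        rw [AlgHom.comp_apply, φi, map_zero]
        exact Ideal.Quotient.eq_zero_iff_mem.2 (Ideal.subset_span rfl)
      · rw [AlgHom.comp_apply, φX l hl]
    exact congrArg (fun f => f x) this
  intro x hx
  have h1 : X j * φ x ∈ Ideal.span S := by
    rw [← φX j hij.symm, ← map_mul]
    exact hmap hx
  have h2 : φ x ∈ Ideal.span S := regularMod_X (hS.trans fun s hs =>
    supported_mono (by intro l hl; simp at hl ⊢; tauto) hs) _ h1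
  have : x = φ x + (x - φ x) := by ring
  rw [this]
  exact Submodule.add_mem_sup h2 (hsub x)

/-- The linear form in the variables `X i`, `X j` that vanishes at `u`. -/
def linForm (i j : σ) (u : Fin 2 → k) : MvPolynomial σ k := C (u 1) * X i - C (u 0) * X j

/-- The coordinate change `X i ↦ linForm i j u`, `X j ↦ linForm i j w`. -/
theorem exists_coordinateChange {i j : σ} (hij : i ≠ j) {u w : Fin 2 → k}
    (h : u 0 * w 1 - u 1 * w 0 ≠ 0) :
    ∃ e : MvPolynomial σ k ≃ₐ[k] MvPolynomial σ k, e (X i) = linForm i j u ∧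
      e (X j) = linForm i j w ∧ ∀ s ∈ supported k {i, j}ᶜ, e s = s := by
  classical
  let Δ := u 0 * w 1 - u 1 * w 0
  let f : MvPolynomial σ k →ₐ[k] MvPolynomial σ k :=
    aeval (Function.update (Function.update X i (linForm i j u)) j (linForm i j w))
  -- The inverse substitution, by Cramer's rule.
  let g : MvPolynomial σ k →ₐ[k] MvPolynomial σ k :=
    aeval (Function.update (Function.update X i (C Δ⁻¹ * (C (u 0) * X j - C (w 0) * X i))) j
      (C Δ⁻¹ * (C (u 1) * X j - C (w 1) * X i)))
  have hΔ : (C Δ⁻¹ : MvPolynomial σ k) * (C (u 0) * C (w 1) - C (u 1) * C (w 0)) = 1 := by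
    rw [← C_mul, ← C_mul, ← C_sub, ← C_mul, inv_mul_cancel₀ h, C_1]
  have fi : f (X i) = linForm i j u := by simp [f, hij]
  have fj : f (X j) = linForm i j w := by simp [f]
  have fl : ∀ l, l ≠ i → l ≠ j → f (X l) = X l := fun l h1 h2 => by simp [f, h1, h2]
  have gi : g (X i) = C Δ⁻¹ * (C (u 0) * X j - C (w 0) * X i) := by simp [g, hij]
  have gj : g (X j) = C Δ⁻¹ * (C (u 1) * X j - C (w 1) * X i) := by simp [g]
  have gl : ∀ l, l ≠ i → l ≠ j → g (X l) = X l := fun l h1 h2 => by simp [g, h1, h2]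
  have fC : ∀ c, f (C c) = C c := fun c => f.commutes c
  have gC : ∀ c, g (C c) = C c := fun c => g.commutes c
  have hfg : f.comp g = AlgHom.id k _ := by
    apply MvPolynomial.algHom_ext
    intro l
    rw [AlgHom.comp_apply, AlgHom.id_apply]
    by_cases h1 : l = i
    · subst h1
      rw [gi]
      simp only [map_mul, map_sub, fC, fi, fj, linForm]
      linear_combination X l * hΔ
    · by_cases h2 : l = j
      · subst h2
        rw [gj]
        simp only [map_mul, map_sub, fC, fi, fj, linForm]
        linear_combination X l * hΔ
      · rw [gl l h1 h2, fl l h1 h2]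
  have hgf : g.comp f = AlgHom.id k _ := by
    apply MvPolynomial.algHom_ext
    intro l
    rw [AlgHom.comp_apply, AlgHom.id_apply]
    by_cases h1 : l = i
    · subst h1
      rw [fi]
      simp only [map_mul, map_sub, gC, gi, gj, linForm]
      linear_combination X l * hΔ
    · by_cases h2 : l = j
      · subst h2
        rw [fj]
        simp only [map_mul, map_sub, gC, gi, gj, linForm]
        linear_combination X l * hΔ
      · rw [fl l h1 h2, gl l h1 h2]
  refine ⟨AlgEquiv.ofAlgHom f g hfg hgf, fi, fj, fun s hs => ?_⟩
  have : supported k {i, j}ᶜ ≤ AlgHom.equalizer f (AlgHom.id k _) := by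
    refine Algebra.adjoin_le ?_
    rintro _ ⟨l, hl, rfl⟩
    simp only [Set.mem_compl_iff, Set.mem_insert_iff, Set.mem_singleton_iff, not_or] at hl
    exact fl l hl.1 hl.2
  exact this hs

theorem RegularMod.map {R : Type*} [CommRing R] {F : Type*} [EquivLike F R R] [RingEquivClass F R R]
    (e : F) {I : Ideal R} {t : R} (h : RegularMod I t) : RegularMod (I.map e) (e t) := by
  intro x hx
  obtain ⟨y, rfl⟩ := EquivLike.surjective e x
  rw [← map_mul] at hx
  have inj : ∀ z, e z ∈ I.map e → z ∈ I := fun z hz => by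
    obtain ⟨z', hz', e'⟩ := (Ideal.mem_map_iff_of_surjective e (EquivLike.surjective e)).1 hz
    rwa [← EquivLike.injective e e']
  exact Ideal.mem_map_of_mem e (h y (inj _ hx))

theorem map_span_of_fixed {R : Type*} [CommRing R] {F : Type*} [EquivLike F R R]
    [RingEquivClass F R R] (e : F) {S : Set R} (h : ∀ s ∈ S, e s = s) :
    (Ideal.span S).map e = Ideal.span S := by
  rw [Ideal.map_span, Set.image_congr h, Set.image_id']

theorem regularMod_sup_linForm {i j : σ} (hij : i ≠ j) {u w : Fin 2 → k}
    (h : u 0 * w 1 - u 1 * w 0 ≠ 0) {S : Set (MvPolynomial σ k)}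
    (hS : S ⊆ (supported k {i, j}ᶜ : Subalgebra k (MvPolynomial σ k))) :
    RegularMod (Ideal.span S ⊔ Ideal.span {linForm i j u}) (linForm i j w) := by
  obtain ⟨e, ei, ej, es⟩ := exists_coordinateChange hij h
  have := (regularMod_sup_X hij hS).map e
  rwa [Ideal.map_sup, map_span_of_fixed e fun s hs => es s (hS hs), ej, Ideal.map_span,
    Set.image_singleton, ei] at this

theorem exists_det_ne_zero {u : Fin 2 → k} (hu : u ≠ 0) :
    ∃ w : Fin 2 → k, u 0 * w 1 - u 1 * w 0 ≠ 0 := by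
  by_cases h : u 0 = 0
  · refine ⟨![1, 0], ?_⟩
    intro h'
    apply hu
    ext l
    fin_cases l
    · exact h
    · simpa using h'
  · exact ⟨![0, 1], by simpa using h⟩

theorem regularMod_linForm {i j : σ} (hij : i ≠ j) {u : Fin 2 → k} (hu : u ≠ 0)
    {S : Set (MvPolynomial σ k)}
    (hS : S ⊆ (supported k {i, j}ᶜ : Subalgebra k (MvPolynomial σ k))) :
    RegularMod (Ideal.span S) (linForm i j u) := by
  obtain ⟨w, h⟩ := exists_det_ne_zero hu
  obtain ⟨e, ei, ej, es⟩ := exists_coordinateChange hij h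
  have := (regularMod_X (hS.trans (fun s hs => supported_mono (t := {i}ᶜ) (by simp) hs))).map e
  rwa [map_span_of_fixed e fun s hs => es s (hS hs), ei] at this

theorem linForm_mem_supported (i j : σ) (u : Fin 2 → k) : linForm i j u ∈ supported k {i, j} :=
  sub_mem (mul_mem ((supported k {i, j}).algebraMap_mem _) (X_mem_supported.2 (by simp)))
    (mul_mem ((supported k {i, j}).algebraMap_mem _) (X_mem_supported.2 (by simp)))

/-- If the determinant vanished, q₁p - p₁q and q₀p - p₀q would be zero, and independence would give
q = 0. -/
theorem det_rep_ne_zero {p q : ℙ k (Fin 2 → k)} (h : p ≠ q) :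
    p.rep 0 * q.rep 1 - p.rep 1 * q.rep 0 ≠ 0 := by
  intro h0
  have hli := (Projectivization.independent_pair_iff_ne p q).2 h
  rw [Projectivization.independent_iff] at hli
  have e : Projectivization.rep ∘ ![p, q] = ![p.rep, q.rep] := by
    funext l; fin_cases l <;> rfl
  rw [e] at hli
  have hpq := LinearIndependent.pair_iff.1 hli
  have h1 := hpq (q.rep 1) (-p.rep 1) (by
    ext l; fin_cases l
    · simp; linear_combination h0
    · simp; ring)
  have h2 := hpq (q.rep 0) (-p.rep 0) (by
    ext l; fin_cases l
    · simp; ring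
    · simp; linear_combination -h0)
  exact q.rep_nonzero (by ext l; fin_cases l <;> simp [h1.1, h2.1])

/-- The product of the linear forms of a family of points. -/
def prodForm {ι : Type*} (i j : σ) (p : ι → ℙ k (Fin 2 → k)) (T : Finset ι) : MvPolynomial σ k :=
  ∏ a ∈ T, linForm i j (p a).rep

variable {ι : Type*} {p : ι → ℙ k (Fin 2 → k)}

theorem prodForm_mem_supported (i j : σ) (p : ι → ℙ k (Fin 2 → k)) (T : Finset ι) :
    prodForm i j p T ∈ supported k {i, j} :=
  prod_mem fun _ _ => linForm_mem_supported _ _ _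

theorem regularMod_prodForm {i j : σ} (hij : i ≠ j) (p : ι → ℙ k (Fin 2 → k)) (T : Finset ι)
    {S : Set (MvPolynomial σ k)}
    (hS : S ⊆ (supported k {i, j}ᶜ : Subalgebra k (MvPolynomial σ k))) :
    RegularMod (Ideal.span S) (prodForm i j p T) :=
  RegularMod.prod _ fun a _ => regularMod_linForm hij (p a).rep_nonzero hS

/-- Products of linear forms at disjoint sets of points form a regular sequence modulo an ideal
that is generated in the other variables. -/
theorem regularMod_sup_prodForm {i j : σ} (hij : i ≠ j) (hp : Function.Injective p)
    {T T' : Finset ι} (hT : Disjoint T T') {S : Set (MvPolynomial σ k)}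
    (hS : S ⊆ (supported k {i, j}ᶜ : Subalgebra k (MvPolynomial σ k))) :
    RegularMod (Ideal.span S ⊔ Ideal.span {prodForm i j p T}) (prodForm i j p T') := by
  refine RegularMod.prod _ fun a ha => ?_
  -- Regularity splits products only in the regular element, so the exchange turns the product over
  -- T into that element.
  refine (regularMod_linForm hij (p a).rep_nonzero hS).exchange ?_
  refine RegularMod.prod _ fun b hb => ?_
  have hab : a ≠ b := fun h => Finset.disjoint_left.1 hT hb (h ▸ ha)
  exact regularMod_sup_linForm hij (det_rep_ne_zero (hp.ne hab)) hS

theorem prodForm_ne_zero {i j : σ} (hij : i ≠ j) (p : ι → ℙ k (Fin 2 → k)) (T : Finset ι) :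
    prodForm i j p T ≠ 0 := by
  intro h
  have := regularMod_prodForm hij p T (Set.empty_subset _) 1 (by rw [h, zero_mul]; exact zero_mem _)
  simp at this

theorem regularMod_span_pair_pow_prodForm {i j : σ} (hij : i ≠ j) (hp : Function.Injective p)
    {T T' : Finset ι} (hT : Disjoint T T') {B : MvPolynomial σ k} (hB : B ∈ supported k {i, j}ᶜ)
    (n : ℕ) : RegularMod (Ideal.span {prodForm i j p T, B} ^ n) (prodForm i j p T') := by
  have hS : ∀ l : ℕ, ({B ^ l} : Set (MvPolynomial σ k)) ⊆
      (supported k {i, j}ᶜ : Subalgebra k (MvPolynomial σ k)) := fun l => by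
    simpa using pow_mem hB l
  -- The swap puts the exponents on B, which lies in the other variables, and leaves the product
  -- form unpowered.
  rw [Set.pair_comm]
  exact RegularMod.span_pair_pow (fun l => regularMod_sup_prodForm hij hp hT (hS l))
    (fun l => regularMod_prodForm hij p T (hS l)) n

/-- Points are merged one at a time by `mem_span_mul_pair_pow`; distinctness supplies the
coprimality. -/
theorem mem_span_prodForm_pow {i j : σ} (hij : i ≠ j) (hp : Function.Injective p)
    (T : Finset ι) {B : MvPolynomial σ k} (hB : B ∈ supported k {i, j}ᶜ) {n : ℕ}
    {f : MvPolynomial σ k} (hf : ∀ a ∈ T, f ∈ Ideal.span {linForm i j (p a).rep, B} ^ n) :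
    f ∈ Ideal.span {prodForm i j p T, B} ^ n := by
  classical
  induction T using Finset.induction_on with
  | empty =>
    have : Ideal.span {prodForm i j p ∅, B} = ⊤ :=
      (Ideal.eq_top_iff_one _).2 (Ideal.subset_span (by simp [prodForm]))
    rw [this, Ideal.top_pow]
    trivial
  | insert a T ha ih =>
    have e : prodForm i j p {a} = linForm i j (p a).rep := Finset.prod_singleton _ _
    have hd : Disjoint {a} T := Finset.disjoint_singleton_left.2 ha
    have e' : prodForm i j p (insert a T) = linForm i j (p a).rep * prodForm i j p T :=
      Finset.prod_insert ha
    rw [e']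
    refine mem_span_mul_pair_pow (fun n => ?_) (fun n => ?_) (hf a (by simp))
      (ih fun b hb => hf b (by simp [hb]))
    · rw [← e]
      exact regularMod_span_pair_pow_prodForm hij hp hd.symm hB n
    · rw [← e]
      exact regularMod_span_pair_pow_prodForm hij hp hd hB n

end LinearForms

/-! ### Grids of points in ℙ¹ × ℙ¹ -/

section Points

variable {k : Type*} [Field k] {ι κ : Type*}

theorem supported_le₀₁ : supported k ({0, 1} : Set (Fin 4)) ≤ supported k {2, 3}ᶜ :=
  supported_mono (by intro l; fin_cases l <;> simp)

theorem supported_le₂₃ : supported k ({2, 3} : Set (Fin 4)) ≤ supported k {0, 1}ᶜ :=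
  supported_mono (by intro l; fin_cases l <;> simp)

/-- The merging is done in each factor in turn: over V for each fixed H, then over H. -/
theorem mem_span_prodForm_prodForm_pow {H : ι → ℙ k (Fin 2 → k)} {V : κ → ℙ k (Fin 2 → k)}
    (hH : Function.Injective H) (hV : Function.Injective V) (T : Finset ι) (U : Finset κ) {n : ℕ}
    {f : CoordRing k} (hf : ∀ i ∈ T, ∀ j ∈ U, f ∈ pointIdeal (H i) (V j) ^ n) :
    f ∈ Ideal.span {prodForm 0 1 H T, prodForm 2 3 V U} ^ n := by
  refine mem_span_prodForm_pow (by decide) hH T (supported_le₂₃ (prodForm_mem_supported _ _ _ _))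
    fun i hi => ?_
  rw [Set.pair_comm]
  refine mem_span_prodForm_pow (by decide) hV U (supported_le₀₁ (linForm_mem_supported _ _ _))
    fun j hj => ?_
  rw [Set.pair_comm]
  exact hf i hi j hj

theorem regularQuadruple_prodForm {H : ι → ℙ k (Fin 2 → k)} {V : κ → ℙ k (Fin 2 → k)}
    (hH : Function.Injective H) (hV : Function.Injective V) {T T' : Finset ι} {U U' : Finset κ}
    (hT : Disjoint T T') (hU : Disjoint U U') :
    RegularQuadruple (R := CoordRing k) (prodForm 0 1 H T) (prodForm 0 1 H T') (prodForm 2 3 V U)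
      (prodForm 2 3 V U') where
  A₁_ne := prodForm_ne_zero (by decide) H T
  A₂_ne := prodForm_ne_zero (by decide) H T'
  B₂_mod_A₁ := regularMod_prodForm (by decide) V U' (by
    simpa using supported_le₀₁ (prodForm_mem_supported _ _ _ _))
  A₁_mod_A₂ := by
    simpa using regularMod_sup_prodForm (i := (0 : Fin 4)) (j := 1) (by decide) hH hT.symm
      (Set.empty_subset _)
  B₁_mod_A₁A₂ := regularMod_prodForm (by decide) V U (by
    simpa using supported_le₀₁ (mul_mem (prodForm_mem_supported _ _ _ _)
      (prodForm_mem_supported _ _ _ _)))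
  A₂_mod_pow := regularMod_span_pair_pow_prodForm (by decide) hH hT
    (supported_le₂₃ (prodForm_mem_supported _ _ _ _))
  B₁_mod_pow_sup := by
    -- The extra generator A₁A₂ also involves only x₀, x₁, so it can join the powers of A₁ as part
    -- of the fixed ideal.
    have hS : ∀ l : ℕ, ({prodForm 0 1 H T ^ l, prodForm 0 1 H T * prodForm 0 1 H T'} :
        Set (CoordRing k)) ⊆ (supported k {2, 3}ᶜ : Subalgebra k (CoordRing k)) := by
      rintro l s (rfl | rfl)
      · exact supported_le₀₁ (pow_mem (prodForm_mem_supported _ _ _ _) l)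
      · exact supported_le₀₁ (mul_mem (prodForm_mem_supported _ _ _ _)
          (prodForm_mem_supported _ _ _ _))
    refine RegularMod.span_pair_pow_sup (fun l => ?_) fun l => ?_
    · rw [← Ideal.span_insert]
      exact regularMod_sup_prodForm (by decide) hV hU.symm (hS l)
    · rw [← Ideal.span_insert]
      exact regularMod_prodForm (by decide) V U' (hS l)

theorem isBihomogeneous_prodForm₀₁ (H : ι → ℙ k (Fin 2 → k)) (T : Finset ι) :
    IsBihomogeneous (prodForm 0 1 H T : CoordRing k) ((T.card : ℤ), 0) := by
  have := IsWeightedHomogeneous.prod T (fun a => (linForm 0 1 (H a).rep : CoordRing k))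
    (fun _ => ((1, 0) : ℤ × ℤ)) (w := bideg) fun a _ => by
      refine (weightedHomogeneousSubmodule k bideg _).sub_mem ?_ ?_
      · simpa [bideg] using (isWeightedHomogeneous_C bideg _).mul (isWeightedHomogeneous_X k bideg 0)
      · simpa [bideg] using (isWeightedHomogeneous_C bideg _).mul (isWeightedHomogeneous_X k bideg 1)
  simpa [IsBihomogeneous, prodForm] using this

theorem isBihomogeneous_prodForm₂₃ (V : ι → ℙ k (Fin 2 → k)) (T : Finset ι) :
    IsBihomogeneous (prodForm 2 3 V T : CoordRing k) (0, (T.card : ℤ)) := by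
  have := IsWeightedHomogeneous.prod T (fun a => (linForm 2 3 (V a).rep : CoordRing k))
    (fun _ => ((0, 1) : ℤ × ℤ)) (w := bideg) fun a _ => by
      refine (weightedHomogeneousSubmodule k bideg _).sub_mem ?_ ?_
      · simpa [bideg] using (isWeightedHomogeneous_C bideg _).mul (isWeightedHomogeneous_X k bideg 2)
      · simpa [bideg] using (isWeightedHomogeneous_C bideg _).mul (isWeightedHomogeneous_X k bideg 3)
  simpa [IsBihomogeneous, prodForm] using this

theorem linForm_mem_irrelevant (i j : Fin 4) (u : Fin 2 → k) :
    linForm i j u ∈ irrelevant k :=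
  Ideal.sub_mem _ (Ideal.mul_mem_left _ _ (Ideal.subset_span ⟨i, rfl⟩))
    (Ideal.mul_mem_left _ _ (Ideal.subset_span ⟨j, rfl⟩))

theorem prodForm_mem_irrelevant (i j : Fin 4) (H : ι → ℙ k (Fin 2 → k)) {T : Finset ι}
    (hT : 0 < T.card) : prodForm i j H T ∈ irrelevant k := by
  obtain ⟨a, ha⟩ := Finset.card_pos.1 hT
  exact Ideal.mem_of_dvd _ (Finset.dvd_prod_of_mem _ ha) (linForm_mem_irrelevant _ _ _)

end Points

/-! ### Maps of free modules given by neighbouring indices -/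

section Coordinates

variable {R : Type*} [CommRing R]

open Classical in
/-- The coordinate with index `q`, which is zero if `q` is not in the index set. -/
def coord (R : Type*) [CommRing R] (ι : Set (ℕ × ℕ × ℕ × ℕ)) (q : ℕ × ℕ × ℕ × ℕ) :
    (ι →₀ R) →ₗ[R] R :=
  if h : q ∈ ι then Finsupp.lapply ⟨q, h⟩ else 0

theorem coord_of_mem {ι : Set (ℕ × ℕ × ℕ × ℕ)} {q : ℕ × ℕ × ℕ × ℕ} (h : q ∈ ι) (v : ι →₀ R) :
    coord R ι q v = v ⟨q, h⟩ := by
  rw [coord, dif_pos h, Finsupp.lapply_apply]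

theorem coord_of_notMem {ι : Set (ℕ × ℕ × ℕ × ℕ)} {q : ℕ × ℕ × ℕ × ℕ} (h : q ∉ ι) (v : ι →₀ R) :
    coord R ι q v = 0 := by
  rw [coord, dif_neg h, LinearMap.zero_apply]

/-- The combination, with coefficients `c₁, …, c₄`, of the coordinates whose index arises from
`(a, b, c, d)` by raising one entry. -/
def stencil (ι : Set (ℕ × ℕ × ℕ × ℕ)) (c₁ c₂ c₃ c₄ : R) : ℕ × ℕ × ℕ × ℕ → (ι →₀ R) →ₗ[R] R :=
  fun (a, b, c, d) => c₁ • coord R ι (a + 1, b, c, d) + c₂ • coord R ι (a, b + 1, c, d) +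
    c₃ • coord R ι (a, b, c + 1, d) + c₄ • coord R ι (a, b, c, d + 1)

/-- The linear map whose coordinates are given by `stencil`. -/
def stencilMap (ι κ : Set (ℕ × ℕ × ℕ × ℕ)) [Finite κ] (c₁ c₂ c₃ c₄ : R) :
    (ι →₀ R) →ₗ[R] (κ →₀ R) :=
  (Finsupp.linearEquivFunOnFinite R R κ).symm.toLinearMap ∘ₗ
    LinearMap.pi fun s => stencil ι c₁ c₂ c₃ c₄ s

theorem stencilMap_apply (ι κ : Set (ℕ × ℕ × ℕ × ℕ)) [Finite κ] (c₁ c₂ c₃ c₄ : R) (v : ι →₀ R)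
    (s : κ) : stencilMap ι κ c₁ c₂ c₃ c₄ v s = stencil ι c₁ c₂ c₃ c₄ s v := rfl

theorem coord_stencilMap {ι κ : Set (ℕ × ℕ × ℕ × ℕ)} [Finite κ] {c₁ c₂ c₃ c₄ : R}
    {q : ℕ × ℕ × ℕ × ℕ} (hq : q ∈ κ) (v : ι →₀ R) :
    coord R κ q (stencilMap ι κ c₁ c₂ c₃ c₄ v) = stencil ι c₁ c₂ c₃ c₄ q v := by
  rw [coord_of_mem hq, stencilMap_apply]

theorem stencilMap_minimal (ι κ : Set (ℕ × ℕ × ℕ × ℕ)) [Finite κ] {c₁ c₂ c₃ c₄ : R}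
    {I : Ideal R} (h₁ : c₁ ∈ I) (h₂ : c₂ ∈ I) (h₃ : c₃ ∈ I) (h₄ : c₄ ∈ I) :
    LinearMap.range (stencilMap ι κ c₁ c₂ c₃ c₄) ≤ I • ⊤ := by
  rintro _ ⟨v, rfl⟩
  rw [← Finsupp.sum_single (stencilMap ι κ c₁ c₂ c₃ c₄ v)]
  refine Submodule.sum_mem _ fun s _ => ?_
  rw [← mul_one (stencilMap ι κ c₁ c₂ c₃ c₄ v s), ← smul_eq_mul, ← Finsupp.smul_single]
  refine Submodule.smul_mem_smul ?_ trivial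
  rw [stencilMap_apply]
  exact I.add_mem (I.add_mem (I.add_mem (I.mul_mem_right _ h₁) (I.mul_mem_right _ h₂))
    (I.mul_mem_right _ h₃)) (I.mul_mem_right _ h₄)

theorem isBihomogeneous_coord {k : Type*} [Field k] {ι : Set (ℕ × ℕ × ℕ × ℕ)}
    {p : ℕ × ℕ × ℕ × ℕ → ℤ × ℤ} {v : ι →₀ CoordRing k} {e : ℤ × ℤ}
    (h : IsBihomogeneousVec (fun s : ι => p s) v e) (q : ℕ × ℕ × ℕ × ℕ) :
    IsBihomogeneous (coord _ ι q v) (e - p q) := by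
  by_cases hq : q ∈ ι
  · rw [coord_of_mem hq]
    exact h ⟨q, hq⟩
  · rw [coord_of_notMem hq]
    exact isWeightedHomogeneous_zero _ _ _

/-- Raising one entry of the index raises the twist by exactly the bidegree of the matching
coefficient. -/
theorem stencilMap_bihomogeneous {k : Type*} [Field k] (ι κ : Set (ℕ × ℕ × ℕ × ℕ)) [Finite κ]
    {c₁ c₂ c₃ c₄ : CoordRing k} {α₁ α₂ β₁ β₂ : ℕ} (h₁ : IsBihomogeneous c₁ (α₁, 0))
    (h₂ : IsBihomogeneous c₂ (α₂, 0)) (h₃ : IsBihomogeneous c₃ (0, β₁))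
    (h₄ : IsBihomogeneous c₄ (0, β₂)) (v : ι →₀ CoordRing k) (e : ℤ × ℤ)
    (hv : IsBihomogeneousVec (fun s : ι => twist α₁ α₂ β₁ β₂ s) v e) :
    IsBihomogeneousVec (fun s : κ => twist α₁ α₂ β₁ β₂ s) (stencilMap ι κ c₁ c₂ c₃ c₄ v) e := by
  rintro ⟨⟨a, b, c, d⟩, hs⟩
  rw [stencilMap_apply]
  have key : ∀ {x y : CoordRing k} {d₁ d₂ d₃ : ℤ × ℤ}, IsBihomogeneous x d₁ →
      IsBihomogeneous y d₂ → d₁ + d₂ = d₃ → IsBihomogeneous (x * y) d₃ := by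
    rintro x y d₁ d₂ _ hx hy rfl
    exact hx.mul hy
  refine IsWeightedHomogeneous.add (IsWeightedHomogeneous.add (IsWeightedHomogeneous.add
    (key h₁ (isBihomogeneous_coord hv _) ?_) (key h₂ (isBihomogeneous_coord hv _) ?_))
    (key h₃ (isBihomogeneous_coord hv _) ?_)) (key h₄ (isBihomogeneous_coord hv _) ?_)
  all_goals
    ext <;> simp [twist] <;> ring

end Coordinates

/-! ### The complex and its exactness -/

section Resolution

instance finite_B₀ (m : ℕ) : Finite (B₀ m) := by
  refine Set.Finite.subset (Set.finite_Iic (m, m, m, m)) ?_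
  rintro ⟨a, b, c, d⟩ ⟨h1, h2, -, h3, h4⟩
  simp only [Set.mem_Iic, Prod.mk_le_mk]
  omega

instance finite_B₁ (m : ℕ) : Finite (B₁ m) := by
  refine Set.Finite.subset (Set.finite_Iic (m + 1, m + 1, m + 1, m + 1)) ?_
  rintro ⟨a, b, c, d⟩ h
  simp only [B₁, Set.mem_ofPred_eq] at h
  simp only [Set.mem_Iic, Prod.mk_le_mk]
  omega

instance finite_B₂ (m : ℕ) : Finite (B₂ m) := by
  refine Set.Finite.subset (Set.finite_Iic (m + 1, m + 1, m + 1, m + 1)) ?_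
  rintro ⟨a, b, c, d⟩ h
  simp only [B₂, Set.mem_ofPred_eq] at h
  simp only [Set.mem_Iic, Prod.mk_le_mk]
  omega

theorem mem_B₀ {m a b c d : ℕ} : (a, b, c, d) ∈ B₀ m ↔ a + d = m ∧ b + c = m ∧ b ≤ a ∧ a ≤ m := by
  simp [B₀]

theorem mem_B₁ {m a b c d : ℕ} : (a, b, c, d) ∈ B₁ m ↔
    (a + d = m + 1 ∧ b + c = m ∧ b < a ∧ a ≤ m) ∨
    (a + d = m ∧ b + c = m + 1 ∧ 0 < b ∧ b ≤ a ∧ a ≤ m) := by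
  simp [B₁]

theorem mem_B₂ {m a b c d : ℕ} : (a, b, c, d) ∈ B₂ m ↔
    a + d = m + 1 ∧ b + c = m + 1 ∧ 0 < b ∧ b < a ∧ a ≤ m := by
  simp [B₂]

variable {R : Type*} [CommRing R] {m : ℕ}

/-- The coordinates of the free module on the generators. -/
def coord₀ (v : B₀ m →₀ R) (a b : ℕ) : R := coord R (B₀ m) (a, b, m - b, m - a) v

/-- The coordinates of the free module on the first syzygies, of the first kind. -/
def coord₁ (v : B₁ m →₀ R) (a b : ℕ) : R := coord R (B₁ m) (a, b, m - b, m + 1 - a) v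

/-- The coordinates of the free module on the first syzygies, of the second kind. -/
def coord₁' (v : B₁ m →₀ R) (a b : ℕ) : R := coord R (B₁ m) (a, b, m + 1 - b, m - a) v

/-- The coordinates of the free module on the second syzygies. -/
def coord₂ (v : B₂ m →₀ R) (a b : ℕ) : R := coord R (B₂ m) (a, b, m + 1 - b, m + 1 - a) v

theorem coord₀_eq_zero (v : B₀ m →₀ R) {a b : ℕ} (h : ¬ (b ≤ a ∧ a ≤ m)) : coord₀ v a b = 0 :=
  coord_of_notMem (by rw [mem_B₀]; omega) v

theorem coord₁_eq_zero (v : B₁ m →₀ R) {a b : ℕ} (h : ¬ (b < a ∧ a ≤ m)) : coord₁ v a b = 0 :=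
  coord_of_notMem (by rw [mem_B₁]; omega) v

theorem coord₁'_eq_zero (v : B₁ m →₀ R) {a b : ℕ} (h : ¬ (0 < b ∧ b ≤ a ∧ a ≤ m)) :
    coord₁' v a b = 0 :=
  coord_of_notMem (by rw [mem_B₁]; omega) v

theorem coord₂_eq_zero (v : B₂ m →₀ R) {a b : ℕ} (h : ¬ (0 < b ∧ b < a ∧ a ≤ m)) :
    coord₂ v a b = 0 :=
  coord_of_notMem (by rw [mem_B₂]; omega) v

theorem coord₀_ext {v w : B₀ m →₀ R} (h : ∀ a b, coord₀ v a b = coord₀ w a b) : v = w := by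
  ext ⟨⟨a, b, c, d⟩, hs⟩
  have hs' := mem_B₀.1 hs
  obtain rfl : c = m - b := by omega
  obtain rfl : d = m - a := by omega
  simpa only [coord₀, coord_of_mem hs] using h a b

theorem coord₁_ext {v w : B₁ m →₀ R} (h : ∀ a b, coord₁ v a b = coord₁ w a b)
    (h' : ∀ a b, coord₁' v a b = coord₁' w a b) : v = w := by
  ext ⟨⟨a, b, c, d⟩, hs⟩
  rcases mem_B₁.1 hs with hs' | hs'
  · obtain rfl : c = m - b := by omega
    obtain rfl : d = m + 1 - a := by omega
    simpa only [coord₁, coord_of_mem hs] using h a b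
  · obtain rfl : c = m + 1 - b := by omega
    obtain rfl : d = m - a := by omega
    simpa only [coord₁', coord_of_mem hs] using h' a b

theorem coord₂_ext {v w : B₂ m →₀ R} (h : ∀ a b, coord₂ v a b = coord₂ w a b) : v = w := by
  ext ⟨⟨a, b, c, d⟩, hs⟩
  have hs' := mem_B₂.1 hs
  obtain rfl : c = m + 1 - b := by omega
  obtain rfl : d = m + 1 - a := by omega
  simpa only [coord₂, coord_of_mem hs] using h a b

theorem exists_coord₀_eq {y : ℕ → ℕ → R} (hy : ∀ a b, ¬ (b ≤ a ∧ a ≤ m) → y a b = 0) :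
    ∃ v : B₀ m →₀ R, ∀ a b, coord₀ v a b = y a b := by
  refine ⟨Finsupp.equivFunOnFinite.symm fun s => y s.1.1 s.1.2.1, fun a b => ?_⟩
  by_cases h : b ≤ a ∧ a ≤ m
  · rw [coord₀, coord_of_mem (mem_B₀.2 (by omega))]
    rfl
  · rw [coord₀_eq_zero _ h, hy a b h]

theorem exists_coord₁_eq {t u : ℕ → ℕ → R} (ht : ∀ a b, ¬ (b < a ∧ a ≤ m) → t a b = 0)
    (hu : ∀ a b, ¬ (0 < b ∧ b ≤ a ∧ a ≤ m) → u a b = 0) :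
    ∃ v : B₁ m →₀ R, (∀ a b, coord₁ v a b = t a b) ∧ ∀ a b, coord₁' v a b = u a b := by
  -- The value of a + d, either m or m + 1, tells the two kinds of edges apart.
  refine ⟨Finsupp.equivFunOnFinite.symm fun s => if s.1.1 + s.1.2.2.2 = m then u s.1.1 s.1.2.1
    else t s.1.1 s.1.2.1, fun a b => ?_, fun a b => ?_⟩
  · by_cases h : b < a ∧ a ≤ m
    · rw [coord₁, coord_of_mem (mem_B₁.2 (by omega))]
      exact if_neg (by simp; omega)
    · rw [coord₁_eq_zero _ h, ht a b h]
  · by_cases h : 0 < b ∧ b ≤ a ∧ a ≤ m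
    · rw [coord₁', coord_of_mem (mem_B₁.2 (by omega))]
      exact if_pos (by simp; omega)
    · rw [coord₁'_eq_zero _ h, hu a b h]

theorem exists_coord₂_eq {g : ℕ → ℕ → R} (hg : ∀ a b, ¬ (0 < b ∧ b < a ∧ a ≤ m) → g a b = 0) :
    ∃ v : B₂ m →₀ R, ∀ a b, coord₂ v a b = g a b := by
  refine ⟨Finsupp.equivFunOnFinite.symm fun s => g s.1.1 s.1.2.1, fun a b => ?_⟩
  by_cases h : 0 < b ∧ b < a ∧ a ≤ m
  · rw [coord₂, coord_of_mem (mem_B₂.2 (by omega))]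
    rfl
  · rw [coord₂_eq_zero _ h, hg a b h]

variable (A₁ A₂ B₁' B₂' : R)

/-- The differential from the first syzygies to the generators. -/
def diff₁ (m : ℕ) : (B₁ m →₀ R) →ₗ[R] (B₀ m →₀ R) :=
  stencilMap (B₁ m) (B₀ m) (-A₁) (-A₂) B₁' B₂'

/-- The differential from the second to the first syzygies. -/
def diff₂ (m : ℕ) : (B₂ m →₀ R) →ₗ[R] (B₁ m →₀ R) :=
  stencilMap (B₂ m) (B₁ m) (-A₁) A₂ (-B₁') B₂'

/-- The map that sends the basis element with index `(a, b, c, d)` to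
`A₁ ^ a * A₂ ^ b * B₁ ^ c * B₂ ^ d`. -/
def genMap (m : ℕ) : (B₀ m →₀ R) →ₗ[R] R :=
  ∑ b ∈ Finset.range (m + 1), ∑ a ∈ Finset.range (m + 1),
    (A₁ ^ a * A₂ ^ b * B₁' ^ (m - b) * B₂' ^ (m - a)) • coord R (B₀ m) (a, b, m - b, m - a)

variable {A₁ A₂ B₁' B₂'}

theorem genMap_apply (v : B₀ m →₀ R) : genMap A₁ A₂ B₁' B₂' m v =
    ∑ b ∈ Finset.range (m + 1), ∑ a ∈ Finset.range (m + 1),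
      coord₀ v a b * (A₁ ^ a * A₂ ^ b * B₁' ^ (m - b) * B₂' ^ (m - a)) := by
  simp only [genMap, LinearMap.sum_apply, LinearMap.smul_apply, smul_eq_mul, coord₀]
  exact Finset.sum_congr rfl fun b _ => Finset.sum_congr rfl fun a _ => mul_comm _ _

theorem stencil_apply (ι : Set (ℕ × ℕ × ℕ × ℕ)) (c₁ c₂ c₃ c₄ : R) (a b c d : ℕ) (v : ι →₀ R) :
    stencil ι c₁ c₂ c₃ c₄ (a, b, c, d) v = c₁ * coord R ι (a + 1, b, c, d) v +
      c₂ * coord R ι (a, b + 1, c, d) v + c₃ * coord R ι (a, b, c + 1, d) v +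
      c₄ * coord R ι (a, b, c, d + 1) v := rfl

theorem coord₀_diff₁ (v : B₁ m →₀ R) (a b : ℕ) : coord₀ (diff₁ A₁ A₂ B₁' B₂' m v) a b =
    B₂' * coord₁ v a b - A₁ * coord₁ v (a + 1) b + B₁' * coord₁' v a b -
      A₂ * coord₁' v a (b + 1) := by
  by_cases h : b ≤ a ∧ a ≤ m
  · rw [coord₀, diff₁, coord_stencilMap (mem_B₀.2 (by omega)), stencil_apply]
    simp only [coord₁, coord₁', Nat.add_sub_add_right]
    rw [show m - b + 1 = m + 1 - b by omega, show m - a + 1 = m + 1 - a by omega]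
    ring
  · rw [coord₀_eq_zero _ h, coord₁_eq_zero v (by omega), coord₁_eq_zero v (by omega),
      coord₁'_eq_zero v (by omega), coord₁'_eq_zero v (by omega)]
    ring

theorem coord₁_diff₂ (v : B₂ m →₀ R) (a b : ℕ) : coord₁ (diff₂ A₁ A₂ B₁' B₂' m v) a b =
    A₂ * coord₂ v a (b + 1) - B₁' * coord₂ v a b := by
  by_cases h : b < a ∧ a ≤ m
  -- Here a + d is already m + 1, so only raising b or c can lead to a square.
  · rw [coord₁, diff₂, coord_stencilMap (mem_B₁.2 (by omega)), stencil_apply,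
      coord_of_notMem (q := (a + 1, _, _, _)) (by rw [mem_B₂]; omega),
      coord_of_notMem (q := (_, _, _, m + 1 - a + 1)) (by rw [mem_B₂]; omega)]
    simp only [coord₂, Nat.add_sub_add_right]
    rw [show m - b + 1 = m + 1 - b by omega]
    ring
  · rw [coord₁_eq_zero _ h, coord₂_eq_zero v (by omega), coord₂_eq_zero v (by omega)]
    ring

theorem coord₁'_diff₂ (v : B₂ m →₀ R) (a b : ℕ) : coord₁' (diff₂ A₁ A₂ B₁' B₂' m v) a b =
    B₂' * coord₂ v a b - A₁ * coord₂ v (a + 1) b := by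
  by_cases h : 0 < b ∧ b ≤ a ∧ a ≤ m
  · rw [coord₁', diff₂, coord_stencilMap (mem_B₁.2 (by omega)), stencil_apply,
      coord_of_notMem (q := (_, b + 1, _, _)) (by rw [mem_B₂]; omega),
      coord_of_notMem (q := (_, _, m + 1 - b + 1, _)) (by rw [mem_B₂]; omega)]
    simp only [coord₂, Nat.add_sub_add_right]
    rw [show m - a + 1 = m + 1 - a by omega]
    ring
  · rw [coord₁'_eq_zero _ h, coord₂_eq_zero v (by omega), coord₂_eq_zero v (by omega)]
    ring

theorem diff₁_diff₂ (v : B₂ m →₀ R) : diff₁ A₁ A₂ B₁' B₂' m (diff₂ A₁ A₂ B₁' B₂' m v) = 0 := by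
  refine coord₀_ext fun a b => ?_
  simp only [coord₀_diff₁, coord₁_diff₂, coord₁'_diff₂]
  simp only [coord₀, map_zero]
  ring

/-- The contribution of t telescopes in a for fixed b, that of u in b for fixed a; the end terms lie
outside the index range and vanish. -/
theorem genMap_diff₁ (v : B₁ m →₀ R) : genMap A₁ A₂ B₁' B₂' m (diff₁ A₁ A₂ B₁' B₂' m v) = 0 := by
  rw [genMap_apply]
  have hfst : ∀ b ∈ Finset.range (m + 1), ∑ a ∈ Finset.range (m + 1),
      (B₂' * coord₁ v a b - A₁ * coord₁ v (a + 1) b) *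
        (A₁ ^ a * A₂ ^ b * B₁' ^ (m - b) * B₂' ^ (m - a)) = 0 := by
    intro b _
    have := Finset.sum_range_sub' (fun a => coord₁ v a b *
        (A₁ ^ a * A₂ ^ b * B₁' ^ (m - b) * B₂' ^ (m + 1 - a))) (m + 1)
    rw [coord₁_eq_zero v (a := 0) (by omega), coord₁_eq_zero v (a := m + 1) (by omega)] at this
    simp only [zero_mul, sub_zero] at this
    rw [← this]
    refine Finset.sum_congr rfl fun a ha => ?_
    have := Finset.mem_range.1 ha
    rw [show m + 1 - a = (m - a) + 1 by omega, Nat.add_sub_add_right]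
    ring
  have hsnd : ∀ a ∈ Finset.range (m + 1), ∑ b ∈ Finset.range (m + 1),
      (B₁' * coord₁' v a b - A₂ * coord₁' v a (b + 1)) *
        (A₁ ^ a * A₂ ^ b * B₁' ^ (m - b) * B₂' ^ (m - a)) = 0 := by
    intro a ha
    have ha' := Finset.mem_range.1 ha
    have := Finset.sum_range_sub' (fun b => coord₁' v a b *
        (A₁ ^ a * A₂ ^ b * B₁' ^ (m + 1 - b) * B₂' ^ (m - a))) (m + 1)
    rw [coord₁'_eq_zero v (b := 0) (by omega), coord₁'_eq_zero v (b := m + 1) (by omega)] at this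
    simp only [zero_mul, sub_zero] at this
    rw [← this]
    refine Finset.sum_congr rfl fun b hb => ?_
    have := Finset.mem_range.1 hb
    rw [show m + 1 - b = (m - b) + 1 by omega, Nat.add_sub_add_right]
    ring
  rw [← add_zero (0 : R)]
  nth_rewrite 1 [← Finset.sum_eq_zero hfst]
  rw [← Finset.sum_eq_zero hsnd, Finset.sum_comm (f := fun a b => (B₁' * coord₁' v a b - _) * _),
    ← Finset.sum_add_distrib]
  refine Finset.sum_congr rfl fun b _ => ?_
  rw [← Finset.sum_add_distrib]
  refine Finset.sum_congr rfl fun a _ => ?_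
  rw [coord₀_diff₁]
  ring

/-- On the kernel A₂ g(a, b+1) = B₁ g(a, b), so vanishing climbs from row b = 0. -/
theorem diff₂_injective [IsDomain R] (hA₂ : A₂ ≠ 0) :
    Function.Injective (diff₂ A₁ A₂ B₁' B₂' m) := by
  rw [injective_iff_map_eq_zero]
  intro v hv
  have h : ∀ b a, coord₂ v a b = 0 := by
    intro b
    induction b with
    | zero => exact fun a => coord₂_eq_zero v (by omega)
    | succ b ih =>
      intro a
      have := coord₁_diff₂ (A₁ := A₁) (A₂ := A₂) (B₁' := B₁') (B₂' := B₂') v a b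
      rw [hv, ih a, coord₁, map_zero, mul_zero, sub_zero] at this
      exact (mul_eq_zero.1 this.symm).resolve_left hA₂
  exact coord₂_ext fun a b => by rw [h, coord₂, map_zero]

theorem RegularQuadruple.exact_diff₂_diff₁ [IsDomain R] (hq : RegularQuadruple A₁ A₂ B₁' B₂') :
    Function.Exact (diff₂ A₁ A₂ B₁' B₂' m) (diff₁ A₁ A₂ B₁' B₂' m) := by
  intro v
  refine ⟨fun hv => ?_, ?_⟩
  · obtain ⟨g, hg, ht, hu⟩ := hq.exists_second_syzygy (m := m) (t := coord₁ v) (u := coord₁' v)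
      (fun a b => coord₁_eq_zero v) (fun a b => coord₁'_eq_zero v)
      (fun a b => by rw [← coord₀_diff₁, hv, coord₀, map_zero])
    obtain ⟨w, hw⟩ := exists_coord₂_eq hg
    refine ⟨w, coord₁_ext (fun a b => ?_) fun a b => ?_⟩
    · rw [coord₁_diff₂, hw, hw, ht]
    · rw [coord₁'_diff₂, hw, hw, hu]
  · rintro ⟨w, rfl⟩
    exact diff₁_diff₂ w

theorem RegularQuadruple.exact_diff₁_genMap [IsDomain R] (hq : RegularQuadruple A₁ A₂ B₁' B₂') :
    Function.Exact (diff₁ A₁ A₂ B₁' B₂' m) (genMap A₁ A₂ B₁' B₂' m) := by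
  intro v
  refine ⟨fun hv => ?_, ?_⟩
  · rw [genMap_apply] at hv
    obtain ⟨t, u, ht, hu, h⟩ := hq.exists_syzygy (fun a b => coord₀_eq_zero v) hv
    obtain ⟨w, hw, hw'⟩ := exists_coord₁_eq ht hu
    exact ⟨w, coord₀_ext fun a b => by rw [coord₀_diff₁, hw, hw, hw', hw', h]⟩
  · rintro ⟨w, rfl⟩
    exact genMap_diff₁ w

theorem RegularQuadruple.exists_genMap_eq [IsDomain R] (hq : RegularQuadruple A₁ A₂ B₁' B₂')
    {f : R} (h : f ∈ Ideal.span {A₁ * A₂, B₁'} ^ m) (h' : f ∈ Ideal.span {A₁, B₂'} ^ m) :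
    ∃ v, genMap A₁ A₂ B₁' B₂' m v = f := by
  obtain ⟨y, hy, e⟩ := hq.exists_eq_sum h h'
  obtain ⟨v, hv⟩ := exists_coord₀_eq hy
  exact ⟨v, by simp only [genMap_apply, hv, e]⟩

end Resolution

/-! ### Bigrading and assembly of the resolution -/

theorem genMap_bihomogeneous {k : Type*} [Field k] {A₁ A₂ C₁ C₂ : CoordRing k}
    {α₁ α₂ β₁ β₂ : ℕ} (h₁ : IsBihomogeneous A₁ (α₁, 0))
    (h₂ : IsBihomogeneous A₂ (α₂, 0)) (h₃ : IsBihomogeneous C₁ (0, β₁))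
    (h₄ : IsBihomogeneous C₂ (0, β₂)) {m : ℕ} (v : B₀ m →₀ CoordRing k) (e : ℤ × ℤ)
    (hv : IsBihomogeneousVec (fun s : B₀ m => twist α₁ α₂ β₁ β₂ s) v e) :
    IsBihomogeneous (genMap A₁ A₂ C₁ C₂ m v) e := by
  simp only [genMap, LinearMap.sum_apply, LinearMap.smul_apply, smul_eq_mul]
  refine (weightedHomogeneousSubmodule k bideg e).sum_mem fun b _ =>
    (weightedHomogeneousSubmodule k bideg e).sum_mem fun a _ => ?_
  have := ((((h₁.pow a).mul (h₂.pow b)).mul (h₃.pow (m - b))).mul (h₄.pow (m - a))).mul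
    (isBihomogeneous_coord hv (a, b, m - b, m - a))
  have hd : a • ((α₁ : ℤ), (0 : ℤ)) + b • ((α₂ : ℤ), (0 : ℤ)) + (m - b) • ((0 : ℤ), (β₁ : ℤ)) +
      (m - a) • ((0 : ℤ), (β₂ : ℤ)) + (e - twist α₁ α₂ β₁ β₂ (a, b, m - b, m - a)) = e := by
    ext <;> simp [twist]
  rwa [hd] at this

theorem exists_minimalResolution {k : Type*} [Field k] {I : Ideal (CoordRing k)} {m : ℕ}
    {A₁ A₂ C₁ C₂ : CoordRing k} (hq : RegularQuadruple A₁ A₂ C₁ C₂) {α₁ α₂ β₁ β₂ : ℕ}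
    (h₁ : IsBihomogeneous A₁ (α₁, 0)) (h₂ : IsBihomogeneous A₂ (α₂, 0))
    (h₃ : IsBihomogeneous C₁ (0, β₁)) (h₄ : IsBihomogeneous C₂ (0, β₂))
    (hA₁ : A₁ ∈ irrelevant k) (hA₂ : A₂ ∈ irrelevant k) (hC₁ : C₁ ∈ irrelevant k)
    (hC₂ : C₂ ∈ irrelevant k)
    (hgen : ∀ a b, b ≤ a → a ≤ m → A₁ ^ a * A₂ ^ b * C₁ ^ (m - b) * C₂ ^ (m - a) ∈ I)
    (hI : ∀ f ∈ I, f ∈ Ideal.span {A₁ * A₂, C₁} ^ m ∧ f ∈ Ideal.span {A₁, C₂} ^ m) :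
    Nonempty (MinimalResolution I (fun s : B₂ m => twist α₁ α₂ β₁ β₂ s)
      (fun s : B₁ m => twist α₁ α₂ β₁ β₂ s) (fun s : B₀ m => twist α₁ α₂ β₁ β₂ s)) := by
  have hneg : ∀ {f : CoordRing k} {e : ℤ × ℤ}, IsBihomogeneous f e → IsBihomogeneous (-f) e :=
    fun {f e} h => (weightedHomogeneousSubmodule k bideg e).neg_mem h
  have hmem : ∀ v, genMap A₁ A₂ C₁ C₂ m v ∈ I := by
    intro v
    rw [genMap_apply]
    refine I.sum_mem fun b _ => I.sum_mem fun a _ => ?_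
    by_cases h : b ≤ a ∧ a ≤ m
    · exact I.mul_mem_left _ (hgen a b h.1 h.2)
    · rw [coord₀_eq_zero v h, zero_mul]
      exact I.zero_mem
  exact ⟨{
    d₂ := diff₂ A₁ A₂ C₁ C₂ m
    d₁ := diff₁ A₁ A₂ C₁ C₂ m
    aug := (genMap A₁ A₂ C₁ C₂ m).codRestrict I hmem
    d₂_bihomogeneous := stencilMap_bihomogeneous _ _ (hneg h₁) h₂ (hneg h₃) h₄
    d₁_bihomogeneous := stencilMap_bihomogeneous _ _ (hneg h₁) (hneg h₂) h₃ h₄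
    aug_bihomogeneous := genMap_bihomogeneous h₁ h₂ h₃ h₄
    d₂_injective := diff₂_injective hq.A₂_ne
    exact₁ := hq.exact_diff₂_diff₁
    exact₀ := fun v => by
      rw [← hq.exact_diff₁_genMap v, Subtype.ext_iff]
      rfl
    aug_surjective := fun ⟨f, hf⟩ => by
      obtain ⟨v, hv⟩ := hq.exists_genMap_eq (hI f hf).1 (hI f hf).2
      exact ⟨v, Subtype.ext hv⟩
    d₂_minimal := stencilMap_minimal _ _ (neg_mem hA₁) hA₂ (neg_mem hC₁) hC₂
    d₁_minimal := stencilMap_minimal _ _ (neg_mem hA₁) (neg_mem hA₂) hC₁ hC₂ }⟩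

/-! ### The ideal of the fat points -/

section FatIdeal

variable {k : Type*} [Field k] {α₁ α₂ β₁ β₂ : ℕ}

/-- The first `α₁` indices. -/
def firstIndices (α₁ α₂ : ℕ) : Finset (Fin (α₁ + α₂)) := Finset.univ.filter fun i => i.val < α₁

/-- The last `α₂` indices. -/
def lastIndices (α₁ α₂ : ℕ) : Finset (Fin (α₁ + α₂)) := Finset.univ.filter fun i => ¬ i.val < α₁

theorem disjoint_firstIndices (α₁ α₂ : ℕ) :
    Disjoint (firstIndices α₁ α₂) (lastIndices α₁ α₂) :=
  Finset.disjoint_filter_filter_not _ _ _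

theorem card_firstIndices (α₁ α₂ : ℕ) : (firstIndices α₁ α₂).card = α₁ := by
  simp [firstIndices, Fin.card_filter_val_lt]

theorem card_lastIndices (α₁ α₂ : ℕ) : (lastIndices α₁ α₂).card = α₂ := by
  have h : (firstIndices α₁ α₂).card + (lastIndices α₁ α₂).card = α₁ + α₂ := by
    simpa [firstIndices, lastIndices] using Finset.card_filter_add_card_filter_not
      (s := (Finset.univ : Finset (Fin (α₁ + α₂)))) (fun i => i.val < α₁)
  rw [card_firstIndices] at h
  omega

theorem mem_fatIdeal {H : Fin (α₁ + α₂) → ℙ k (Fin 2 → k)} {V : Fin (β₁ + β₂) → ℙ k (Fin 2 → k)}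
    {m : ℕ} {f : CoordRing k} : f ∈ fatIdeal (α₁ := α₁) (α₂ := α₂) (β₁ := β₁) (β₂ := β₂) H V m m m ↔
      ∀ i j, i.val < α₁ ∨ j.val < β₁ → f ∈ pointIdeal (H i) (V j) ^ m := by
  simp only [fatIdeal, Ideal.mem_iInf, mult]
  refine forall_congr' fun i => forall_congr' fun j => ?_
  by_cases hi : i.val < α₁ <;> by_cases hj : j.val < β₁ <;> simp [hi, hj]

theorem linForm_dvd_prodForm {σ ι : Type*} (i j : σ) (p : ι → ℙ k (Fin 2 → k)) {T : Finset ι}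
    {a : ι} (ha : a ∈ T) : linForm i j (p a).rep ∣ prodForm i j p T :=
  Finset.dvd_prod_of_mem _ ha

/-- Orders of vanishing are counted block by block: a + (m - b) ≥ m by b ≤ a, a + (m - a) = m, and b
+ (m - b) = m. -/
theorem generator_mem_fatIdeal (H : Fin (α₁ + α₂) → ℙ k (Fin 2 → k))
    (V : Fin (β₁ + β₂) → ℙ k (Fin 2 → k)) {m a b : ℕ} (hab : b ≤ a) (ha : a ≤ m) :
    prodForm 0 1 H (firstIndices α₁ α₂) ^ a * prodForm 0 1 H (lastIndices α₁ α₂) ^ b *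
      prodForm 2 3 V (firstIndices β₁ β₂) ^ (m - b) *
      prodForm 2 3 V (lastIndices β₁ β₂) ^ (m - a) ∈ fatIdeal H V m m m := by
  rw [mem_fatIdeal]
  intro i j hij
  have hf : ∀ {n l : ℕ} {x : Fin (n + l)}, x.val < n → x ∈ firstIndices n l := fun h => by
    simpa [firstIndices] using h
  have hl : ∀ {n l : ℕ} {x : Fin (n + l)}, ¬ x.val < n → x ∈ lastIndices n l := fun h => by
    simpa [lastIndices] using h
  by_cases hi : i.val < α₁
  · by_cases hj : j.val < β₁
    · refine Ideal.mem_of_dvd _ ?_ (mul_pow_mem_span_pair_pow (p := a) (q := m - b)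
        (linForm_dvd_prodForm 0 1 H (hf hi)) (linForm_dvd_prodForm 2 3 V (hf hj)) (by omega))
      exact ⟨prodForm 0 1 H (lastIndices α₁ α₂) ^ b * prodForm 2 3 V (lastIndices β₁ β₂) ^ (m - a),
        by ring⟩
    · refine Ideal.mem_of_dvd _ ?_ (mul_pow_mem_span_pair_pow (p := a) (q := m - a)
        (linForm_dvd_prodForm 0 1 H (hf hi)) (linForm_dvd_prodForm 2 3 V (hl hj)) (by omega))
      exact ⟨prodForm 0 1 H (lastIndices α₁ α₂) ^ b * prodForm 2 3 V (firstIndices β₁ β₂) ^ (m - b),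
        by ring⟩
  · refine Ideal.mem_of_dvd _ ?_ (mul_pow_mem_span_pair_pow (p := b) (q := m - b)
      (linForm_dvd_prodForm 0 1 H (hl hi))
      (linForm_dvd_prodForm 2 3 V (hf (hij.resolve_left hi))) (by omega))
    exact ⟨prodForm 0 1 H (firstIndices α₁ α₂) ^ a * prodForm 2 3 V (lastIndices β₁ β₂) ^ (m - a),
      by ring⟩

end FatIdeal

end FatACI
end

theorem corollary3p7 {k : Type*} [Field k] (α₁ α₂ β₁ β₂ : ℕ)
    (hα₁ : 0 < α₁) (hα₂ : 0 < α₂) (hβ₁ : 0 < β₁) (hβ₂ : 0 < β₂)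
    (H : Fin (α₁ + α₂) → Projectivization k (Fin 2 → k)) (hH : Function.Injective H)
    (V : Fin (β₁ + β₂) → Projectivization k (Fin 2 → k)) (hV : Function.Injective V)
    (m : ℕ) :
    Nonempty (FatACI.MinimalResolution (FatACI.fatIdeal (α₁ := α₁) (α₂ := α₂) (β₁ := β₁) (β₂ := β₂) H V m m m)
      (fun s : FatACI.B₂ m => FatACI.twist α₁ α₂ β₁ β₂ s)
      (fun s : FatACI.B₁ m => FatACI.twist α₁ α₂ β₁ β₂ s)
      (fun s : FatACI.B₀ m => FatACI.twist α₁ α₂ β₁ β₂ s)) := by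
  have hα₁' := FatACI.card_firstIndices α₁ α₂
  have hα₂' := FatACI.card_lastIndices α₁ α₂
  have hβ₁' := FatACI.card_firstIndices β₁ β₂
  have hβ₂' := FatACI.card_lastIndices β₁ β₂
  refine FatACI.exists_minimalResolution (FatACI.regularQuadruple_prodForm hH hV
    (FatACI.disjoint_firstIndices α₁ α₂) (FatACI.disjoint_firstIndices β₁ β₂)) ?_ ?_ ?_ ?_
    -- Positivity of the four numbers makes the products nonempty, which gives minimality.
    (FatACI.prodForm_mem_irrelevant _ _ _ (by omega))
    (FatACI.prodForm_mem_irrelevant _ _ _ (by omega))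
    (FatACI.prodForm_mem_irrelevant _ _ _ (by omega))
    (FatACI.prodForm_mem_irrelevant _ _ _ (by omega))
    (fun a b hab ha => FatACI.generator_mem_fatIdeal H V hab ha) fun f hf => ?_
  · simpa only [hα₁'] using FatACI.isBihomogeneous_prodForm₀₁ H (FatACI.firstIndices α₁ α₂)
  · simpa only [hα₂'] using FatACI.isBihomogeneous_prodForm₀₁ H (FatACI.lastIndices α₁ α₂)
  · simpa only [hβ₁'] using FatACI.isBihomogeneous_prodForm₂₃ V (FatACI.firstIndices β₁ β₂)
  · simpa only [hβ₂'] using FatACI.isBihomogeneous_prodForm₂₃ V (FatACI.lastIndices β₁ β₂)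
  · rw [FatACI.mem_fatIdeal] at hf
    constructor
    -- The columns j < β₁ carry multiplicity m at every H, so the first grid uses all of H.
    · have e : FatACI.prodForm (0 : Fin 4) 1 H (FatACI.firstIndices α₁ α₂) *
          FatACI.prodForm 0 1 H (FatACI.lastIndices α₁ α₂) =
          FatACI.prodForm 0 1 H Finset.univ := Finset.prod_filter_mul_prod_filter_not _ _ _
      rw [e]
      exact FatACI.mem_span_prodForm_prodForm_pow hH hV _ _ fun i _ j hj =>
        hf i j (Or.inr (Finset.mem_filter.1 hj).2)
    · exact FatACI.mem_span_prodForm_prodForm_pow hH hV _ _ fun i hi j _ =>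
        hf i j (Or.inl (Finset.mem_filter.1 hi).2)
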